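/- A scalable group is a topological group $G$ with identity $e$ together with a continuous map $\delta:\mathbb R\times G\to G$, written $\delta_t=\delta(t,\cdot)$, such that $\delta_t$ is an automorphism of the topological group $G$ for every $t\neq 0$, $\delta_s\circ\delta_t=\delta_{st}$ for all $s,t\in\mathbb R$, and $\delta_0\equiv e$. A metric scalable group is a scalable group whose topology is induced by a left-invariant distance $d$ with $d(\delta_t(p),\delta_t(q))=|t|\,d(p,q)$ for all $t\in\mathbb R$ and $p,q\in G$. The first layer of $G$ is $$V_1(G)=\{p\in G:\ \delta_{t+s}(p)=\delta_t(p)\,\delta_s(p)\ \text{ for all } t,s\in\mathbb R\}.$$ For $a\in V_1(G)\setminus\{e\}$ let $\mathcal U(a)$ be the class of the Borel sets $A\subseteq G$ such that for every $g\in G$ the set $\{t\in\mathbb R:\ g\,\delta_t(a)\in A\}$ has Lebesgue measure zero. For a sequence $(a_n)_{n\ge 1}$ in $V_1(G)\setminus\{e\}$ let $\mathcal U(\{a_n\})$ be the class of the Borel sets $A\subseteq G$ of the form $A=\bigcup_{n\ge1} A_n$ with $A_n\in\mathcal U(a_n)$ for every $n$. For a sequence $(N_m)_{m\ge 1}$ of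 locally compact subgroups of $G$, a Borel set $\Omega\subseteq G$ is called $(N_m)$-negligible if $\Omega=\bigcup_{m\ge 1}\Omega_m$ with Borel sets $\Omega_m$ such that $\operatorname{vol}_{N_m}(N_m\cap g\,\Omega_m)=0$ for all $m\ge 1$ and $g\in G$, where $\operatorname{vol}_{N_m}$ is any Haar measure on $N_m$. **Theorem.** Let $G$ be a metric scalable group and let $(a_n)_{n\ge 1}$ be a dense sequence in $V_1(G)\setminus\{e\}$. For $m\ge1$ let $N_m$ be the subgroup generated by $a_1,\dots,a_m$ as a scalable group, that is, the closure of the group generated by $\{\delta_t(a_i):\ 1\le i\le m,\ t\in\mathbb R\}$. Suppose that $N_m$ is nilpotent for every $m\ge 1$. Then every $N_m$ is locally compact, and a set $\Omega\subseteq G$ belongs to $\mathcal U(\{a_n\})$ if and only if it is $(N_m)$-negligible. -/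

import Mathlib

open MeasureTheory

/-- A scalable group: a topological group `G` with a jointly continuous family of dilations
`δ_t`, `t : ℝ`, such that `δ_t` is an automorphism of the topological group `G` for `t ≠ 0`,
`δ_s ∘ δ_t = δ_{s t}`, and `δ_0` is the constant map with value the identity. -/
class ScalableGroup (G : Type*) [Group G] [TopologicalSpace G] [IsTopologicalGroup G] where
  /-- The dilation `δ_t`. -/
  dil : ℝ → G → G
  continuous_dil : Continuous fun x : ℝ × G => dil x.1 x.2
  dil_aut : ∀ t : ℝ, t ≠ 0 → ∃ e : G ≃ₜ* G, ∀ p : G, e p = dil t p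
  dil_dil : ∀ (s t : ℝ) (p : G), dil s (dil t p) = dil (s * t) p
  dil_zero : ∀ p : G, dil 0 p = 1

/-- A metric scalable group: the topology of the scalable group `G` is the one of a distance that
is left-invariant and satisfies `d (δ_t p, δ_t q) = |t| d (p, q)`. -/
class MetricScalableGroup (G : Type*) [Group G] [MetricSpace G] [IsTopologicalGroup G]
    extends ScalableGroup G where
  dist_mul_left : ∀ g p q : G, dist (g * p) (g * q) = dist p q
  dist_dil : ∀ (t : ℝ) (p q : G), dist (dil t p) (dil t q) = |t| * dist p q

namespace ScalableGroup

section Layer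

variable (G : Type*) [Group G] [TopologicalSpace G] [IsTopologicalGroup G] [ScalableGroup G]

/-- The first layer `V_1(G)`: the points `p` for which `t ↦ δ_t p` is a one-parameter subgroup. -/
def firstLayer : Set G :=
  {p : G | ∀ t s : ℝ, dil (t + s) p = dil t p * dil s p}

end Layer

section Classes

variable {G : Type*} [Group G] [TopologicalSpace G] [IsTopologicalGroup G] [ScalableGroup G]

/-- The scalable subgroup generated by a set `A`: the closure of the group generated by all
`δ_t a` with `a ∈ A` and `t : ℝ`. -/
def generatedBy (A : Set G) : Subgroup G :=
  (Subgroup.closure {x : G | ∃ a ∈ A, ∃ t : ℝ, x = dil t a}).topologicalClosure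

/-- The subgroup generated, as a scalable group, by the first `m + 1` terms `a 0, …, a m`. -/
def initialSubgroup (a : ℕ → G) (m : ℕ) : Subgroup G :=
  generatedBy {x : G | ∃ i ≤ m, x = a i}

variable [MeasurableSpace G]

/-- The class `𝒰(a)` of the Borel sets that meet every curve `t ↦ g δ_t a` in a set of
one-dimensional Lebesgue measure zero. -/
def exceptionalAt (a : G) : Set (Set G) :=
  {A : Set G | MeasurableSet A ∧ ∀ g : G, volume {t : ℝ | g * dil t a ∈ A} = 0}

/-- The class `𝒰({a_n})` of the Borel sets that are a union of sets `A_n ∈ 𝒰(a_n)`. -/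
def exceptional (a : ℕ → G) : Set (Set G) :=
  {A : Set G | MeasurableSet A ∧
    ∃ B : ℕ → Set G, (∀ n, B n ∈ exceptionalAt (a n)) ∧ A = ⋃ n, B n}

end Classes

end ScalableGroup

section Negligible

variable {G : Type*} [Group G] [TopologicalSpace G] [IsTopologicalGroup G] [MeasurableSpace G]

/-- `vol_H (H ∩ A) = 0`, where `vol_H` is any Haar measure of the subgroup `H`. Local compactness
of `H` is part of the definition, so that Haar measures do exist on `H`. -/
def IsHaarNullOn (H : Subgroup G) (A : Set G) : Prop :=
  LocallyCompactSpace H ∧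
    ∀ μ : Measure H, μ.IsHaarMeasure → μ {h : H | (h : G) ∈ A} = 0

/-- A set `Ω` is `(N_m)`-negligible if it is Borel and it is the union of Borel sets `Ω_m` with
`vol_{N_m} (N_m ∩ g Ω_m) = 0` for all `m` and all `g : G`. -/
def IsNegligible (N : ℕ → Subgroup G) (Ω : Set G) : Prop :=
  MeasurableSet Ω ∧ ∃ B : ℕ → Set G, (∀ m, MeasurableSet (B m)) ∧ Ω = (⋃ m, B m) ∧
    ∀ (m : ℕ) (g : G), IsHaarNullOn (N m) ((fun x => g * x) '' B m)

end Negligible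

/-!
Let `N` be one of the groups `N_m`, and let `H` be the group generated by the lines `t ↦ δ_t a_i`,
`i ≤ m`, so that `N` is the closure of `H`. The proof rests on polynomial coordinates for `H`.

**Coordinates.** A nilpotent scalable group generated by finitely many lines of its first layer is
homeomorphic to some `ℝ^n` (`ScalableGroup.exists_homogeneousChart`). By induction on the class `s`,
where `s ≥ 2`: the last term of the lower central series is generated by commutators of a top degree
curve of the quotient with a line. By homogeneity these depend bilinearly over `ℝ` on the two
parameters, so that the last term is the image of some `ℝ^k` under a homomorphism, homogeneous of
degree `s` (`ScalableGroup.exists_generating_curves`). Rescaling to the unit sphere shows that such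
an image is closed (`ScalableGroup.isClosedEmbedding_of_homogeneous`), and every homogeneous
one-parameter subgroup of the quotient has a unique lift that is homogeneous of the same degree
(`ScalableGroup.CentralLayer.exists_curve_lift`). The coordinates are of the second kind, along
homogeneous one-parameter subgroups, and no Lie theory is involved. A consequence is that `H` is
locally compact, hence closed, hence equal to `N`.

**Polynomials.** Polynomial maps into a group with its lower central series are closed under products
(`IsPolyMap.closure_properties`, the Lazard–Leibman theorem), and in the coordinates they are
continuous functions with vanishing iterated differences, hence polynomials
(`IsPolyDeg.exists_mvPolynomial`). This applies to left translations and to the word maps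
`t ↦ δ_{t_1} a_{i_1} ⋯ δ_{t_L} a_{i_L}`. Translations thus preserve Lebesgue null sets, so that Haar
null sets are Lebesgue null in the coordinates. The induction also writes the inverse of the chart
as a word in the `a_i` with differentiable exponents; the corresponding word map has a
differentiable right inverse, so its derivative is onto somewhere, and, the map being polynomial,
almost everywhere. It therefore pulls Haar null sets back to Lebesgue null sets
(`ScalableGroup.HomogeneousChart.IsPolynomial.exists_word_preimage_null`).

**Exceptional sets.** One direction of the theorem is Fubini's theorem: a set that is null on every
line in the direction `a_m` is Haar null in `N_m`. In the other direction, let `B` be null on all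
translates of `N_m`. By the above, from every point of `G`, some fixed word leads into `B` only for
a null set of parameters. Remove from `B` the points whose line in the direction of the last letter
meets `B` in a null set: what is removed is exceptional in that direction. Replace `B` by the set of
all points whose line meets `B` in a set of positive measure, and go on with the previous letter.
After the last step nothing is left, by Fubini's theorem, so that `B` is covered by exceptional
sets in the directions `a_i`, `i ≤ m` (`ScalableGroup.exists_exceptionalAt_cover`).
-/

open scoped commutatorElement

/-! ### Dilations as homomorphisms -/

namespace ScalableGroup

section Basic

variable {G : Type*} [Group G] [TopologicalSpace G] [IsTopologicalGroup G] [ScalableGroup G]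

theorem dil_mul (t : ℝ) (p q : G) : dil t (p * q) = dil t p * dil t q := by
  rcases eq_or_ne t 0 with rfl | ht
  · simp [dil_zero]
  · obtain ⟨e, he⟩ := dil_aut (G := G) t ht
    simp only [← he, map_mul]

theorem dil_one (p : G) : dil 1 p = p := by
  obtain ⟨e, he⟩ := dil_aut (G := G) 1 one_ne_zero
  apply e.injective
  rw [he, he, dil_dil, one_mul]

/-- The dilation `δ_t` as an endomorphism of the group; for `t = 0` it is trivial. -/
def dilHom (t : ℝ) : G →* G := MonoidHom.mk' (dil t) (dil_mul t)

@[simp] theorem dilHom_apply (t : ℝ) (p : G) : dilHom t p = dil t p := rfl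

@[simp] theorem dil_map_one (t : ℝ) : dil t (1 : G) = 1 := map_one (dilHom t)

theorem dil_pow (t : ℝ) (p : G) (n : ℕ) : dil t (p ^ n) = dil t p ^ n := map_pow (dilHom t) p n

theorem dil_commutatorElement (t : ℝ) (p q : G) : dil t ⁅p, q⁆ = ⁅dil t p, dil t q⁆ :=
  map_commutatorElement (dilHom t) p q

theorem _root_.Continuous.dil {X : Type*} [TopologicalSpace X] {f : X → ℝ} {g : X → G}
    (hf : Continuous f) (hg : Continuous g) : Continuous fun x => ScalableGroup.dil (f x) (g x) :=
  continuous_dil.comp (hf.prodMk hg)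

theorem dil_neg_of_mem_firstLayer {a : G} (ha : a ∈ firstLayer G) (t : ℝ) :
    dil (-t) a = (dil t a)⁻¹ := by
  have h := ha t (-t)
  rw [add_neg_cancel, dil_zero] at h
  exact (inv_eq_of_mul_eq_one_right h.symm).symm

end Basic

/-- A scalable group from a continuous action of `(ℝ, ·)` by endomorphisms: the inverse of `δ_t`
is `δ_{1/t}`. -/
@[reducible] def ofHom {G : Type*} [Group G] [TopologicalSpace G] [IsTopologicalGroup G]
    (d : ℝ → G →* G) (hcont : Continuous fun x : ℝ × G => d x.1 x.2)
    (hmul : ∀ s t p, d s (d t p) = d (s * t) p) (hzero : ∀ p, d 0 p = 1)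
    (hone : ∀ p, d 1 p = p) : ScalableGroup G where
  dil t p := d t p
  continuous_dil := hcont
  dil_aut t ht :=
    ⟨{ toFun := d t
       invFun := d t⁻¹
       left_inv := fun p => by rw [hmul, inv_mul_cancel₀ ht, hone]
       right_inv := fun p => by rw [hmul, mul_inv_cancel₀ ht, hone]
       map_mul' := map_mul _
       continuous_toFun := hcont.comp (Continuous.prodMk_right t)
       continuous_invFun := hcont.comp (Continuous.prodMk_right t⁻¹) }, fun _ => rfl⟩
  dil_dil := hmul
  dil_zero := hzero

end ScalableGroup

/-! ### Polynomial maps into a filtered group -/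

section PolyMap

variable {V N Q : Type*} [AddCommGroup V] [Group N] [Group Q]

/-- The lower central series `Γ 1 = N, Γ 2 = [N, N], …`, extended by `Γ 0 = N`. -/
def lcsFiltration (N : Type*) [Group N] (i : ℕ) : Subgroup N :=
  (⊤ : Subgroup N).lowerCentralSeries (i - 1)

instance (i : ℕ) : (lcsFiltration N i).Normal := by unfold lcsFiltration; infer_instance

theorem lcsFiltration_antitone : Antitone (lcsFiltration N) := fun i j h =>
  Subgroup.lowerCentralSeries_antitone _ (by omega)

/-- `[Γ (i + 1), Γ (j + 1)] ≤ Γ (i + j + 2)` for the lower central series, which Mathlib numbers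
from `0`. -/
theorem commutator_lowerCentralSeries_le (i j : ℕ) :
    ⁅(⊤ : Subgroup N).lowerCentralSeries i, (⊤ : Subgroup N).lowerCentralSeries j⁆ ≤
      (⊤ : Subgroup N).lowerCentralSeries (i + j + 1) := by
  induction j generalizing i with
  | zero => exact le_rfl
  | succ j ih =>
    -- The three subgroups lemma modulo the normal subgroup `lcs (i + j + 2)`.
    set L := (⊤ : Subgroup N).lowerCentralSeries
    set M := L (i + (j + 1) + 1) with hM
    have key : ∀ H : Subgroup N, H ≤ M ↔ H.map (QuotientGroup.mk' M) = ⊥ := fun H => by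
      rw [Subgroup.map_eq_bot_iff, QuotientGroup.ker_mk']
    have e : L (j + 1) = ⁅L j, ⊤⁆ := rfl
    rw [Subgroup.commutator_comm, e, key, Subgroup.map_commutator, Subgroup.map_commutator]
    apply Subgroup.commutator_commutator_eq_bot_of_rotate
    · rw [← Subgroup.map_commutator, ← Subgroup.map_commutator, ← key, Subgroup.commutator_comm ⊤]
      have h := ih (i + 1)
      rw [show i + 1 + j + 1 = i + (j + 1) + 1 by omega] at h
      exact h
    · rw [← Subgroup.map_commutator, ← Subgroup.map_commutator, ← key]
      exact Subgroup.commutator_mono (ih i) le_rfl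

theorem commutatorElement_mem_lcsFiltration {i j : ℕ} {x y : N} (hx : x ∈ lcsFiltration N i)
    (hy : y ∈ lcsFiltration N j) : ⁅x, y⁆ ∈ lcsFiltration N (i + j) := by
  rcases Nat.eq_zero_or_pos i with rfl | hi
  · rw [zero_add]
    exact Subgroup.commutator_le_right _ _ (Subgroup.commutator_mem_commutator hx hy)
  rcases Nat.eq_zero_or_pos j with rfl | hj
  · exact Subgroup.commutator_le_left _ _ (Subgroup.commutator_mem_commutator hx hy)
  have h := commutator_lowerCentralSeries_le (N := N) (i - 1) (j - 1)
    (Subgroup.commutator_mem_commutator hx hy)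
  rwa [show i - 1 + (j - 1) + 1 = i + j - 1 by omega] at h

/-- `IsPolyMap k i f`: the map `f : V → N` takes values in `Γ i`, and each of its first `k`
successive multiplicative differences `f(v)⁻¹ f(v + h)` gains one step in the filtration `Γ`. -/
def IsPolyMap : ℕ → ℕ → (V → N) → Prop
  | 0, i, f => ∀ v, f v ∈ lcsFiltration N i
  | k + 1, i, f => (∀ v, f v ∈ lcsFiltration N i) ∧
      ∀ h, IsPolyMap k (i + 1) fun v => (f v)⁻¹ * f (v + h)

namespace IsPolyMap

theorem of_succ {k i : ℕ} {f : V → N} (hf : IsPolyMap (k + 1) i f) : IsPolyMap k i f := by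
  induction k generalizing i f with
  | zero => exact hf.1
  | succ k ih => exact ⟨hf.1, fun h => ih (hf.2 h)⟩

theorem mono {k i j : ℕ} (hij : j ≤ i) {f : V → N} (hf : IsPolyMap k i f) : IsPolyMap k j f := by
  induction k generalizing i j f with
  | zero => exact fun v => lcsFiltration_antitone hij (hf v)
  | succ k ih =>
    exact ⟨fun v => lcsFiltration_antitone hij (hf.1 v), fun h => ih (by omega) (hf.2 h)⟩

theorem const (k : ℕ) (x : N) : IsPolyMap k 0 fun _ : V => x := by
  have one : ∀ k i, IsPolyMap k i fun _ : V => (1 : N) := by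
    intro k
    induction k with
    | zero => exact fun i v => one_mem _
    | succ k ih => exact fun i => ⟨fun v => one_mem _, fun h => by simpa using ih (i + 1)⟩
  cases k with
  | zero => exact fun v => Subgroup.mem_top x
  | succ k => exact ⟨fun v => Subgroup.mem_top x, fun h => by simpa using one k 1⟩

/-- The Lazard–Leibman theorem: polynomial maps are closed under products, inverses and
commutators, all three by a simultaneous induction on the number of differences. -/
theorem closure_properties (k : ℕ) :
    (∀ (i : ℕ) (f g : V → N), IsPolyMap k i f → IsPolyMap k i g →
      IsPolyMap k i fun v => f v * g v) ∧
    (∀ (i : ℕ) (f : V → N), IsPolyMap k i f → IsPolyMap k i fun v => (f v)⁻¹) ∧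
    ∀ (i j : ℕ) (f g : V → N), IsPolyMap k i f → IsPolyMap k j g →
      IsPolyMap k (i + j) fun v => ⁅f v, g v⁆ := by
  induction k with
  | zero =>
    exact ⟨fun i f g hf hg v => mul_mem (hf v) (hg v), fun i f hf v => inv_mem (hf v),
      fun i j f g hf hg v => commutatorElement_mem_lcsFiltration (hf v) (hg v)⟩
  | succ k ih =>
    obtain ⟨hmul, hinv, hcomm⟩ := ih
    have hconj : ∀ (i : ℕ) (f g : V → N), IsPolyMap k i f → IsPolyMap k 0 g →
        IsPolyMap k i fun v => g v * f v * (g v)⁻¹ := by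
      intro i f g hf hg
      have := hmul i _ _ ((hcomm 0 i g f hg hf).mono (by omega)) hf
      simpa [commutatorElement_def] using this
    refine ⟨?_, ?_, ?_⟩
    · intro i f g hf hg
      refine ⟨fun v => mul_mem (hf.1 v) (hg.1 v), fun h => ?_⟩
      have h1 := hmul _ _ _ (hconj _ _ _ (hf.2 h)
        (hinv _ _ (hg.of_succ.mono (Nat.zero_le i)))) (hg.2 h)
      convert h1 using 2 with v
      group
    · intro i f hf
      refine ⟨fun v => inv_mem (hf.1 v), fun h => ?_⟩
      have h1 := hconj _ _ _ (hinv _ _ (hf.2 h)) (hf.of_succ.mono (Nat.zero_le i))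
      convert h1 using 2 with v
      group
    · intro i j f g hf hg
      refine ⟨fun v => commutatorElement_mem_lcsFiltration (hf.1 v) (hg.1 v), fun h => ?_⟩
      have f0 := hf.of_succ.mono (Nat.zero_le i)
      have g0 := hg.of_succ.mono (Nat.zero_le j)
      have c := hinv _ _ ((hcomm _ _ _ _ hf.of_succ hg.of_succ).mono (Nat.zero_le (i + j)))
      have hu := hcomm _ _ _ _ (hf.2 h)
        (hmul _ _ _ hg.of_succ ((hg.2 h).mono (Nat.le_succ j)))
      have hw := hcomm _ _ _ _ hf.of_succ (hg.2 h)
      rw [show i + 1 + j = i + j + 1 by omega] at hu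
      rw [show i + (j + 1) = i + j + 1 by omega] at hw
      -- With `f' = f(v)⁻¹ f(v + h)` and `g'` likewise,
      -- `⁅f f', g g'⁆ = f ⁅f', g g'⁆ f⁻¹ * ⁅f, g⁆ * g ⁅f, g'⁆ g⁻¹`.
      have h1 := hmul _ _ _ (hconj _ _ _ (hconj _ _ _ hu f0) c) (hconj _ _ _ hw g0)
      convert h1 using 2 with v
      simp only [commutatorElement_def]
      group

theorem mul {k i : ℕ} {f g : V → N} (hf : IsPolyMap k i f) (hg : IsPolyMap k i g) :
    IsPolyMap k i fun v => f v * g v := (closure_properties k).1 i f g hf hg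

theorem inv {k i : ℕ} {f : V → N} (hf : IsPolyMap k i f) : IsPolyMap k i fun v => (f v)⁻¹ :=
  (closure_properties k).2.1 i f hf

theorem list_prod {k n : ℕ} {f : Fin n → V → N} (hf : ∀ j, IsPolyMap k 0 (f j)) :
    IsPolyMap k 0 fun v => (List.ofFn fun j => f j v).prod := by
  induction n with
  | zero => simpa using const k (1 : N)
  | succ n ih =>
    simp only [List.ofFn_succ, List.prod_cons]
    exact (hf 0).mul (ih fun j => hf j.succ)

theorem map (π : N →* Q) {k i : ℕ} {f : V → N} (hf : IsPolyMap k i f) :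
    IsPolyMap k i fun v => π (f v) := by
  have hΓ : ∀ i x, x ∈ lcsFiltration N i → π x ∈ lcsFiltration Q i := fun i x hx => by
    have h := Subgroup.mem_map_of_mem π hx
    rw [lcsFiltration, Subgroup.map_lowerCentralSeries] at h
    exact Subgroup.lowerCentralSeries_mono _ le_top h
  induction k generalizing i f with
  | zero => exact fun v => hΓ _ _ (hf v)
  | succ k ih => exact ⟨fun v => hΓ _ _ (hf.1 v), fun h => by simpa using ih (hf.2 h)⟩

end IsPolyMap

/-- `IsPolyDeg k q`: the `k`-th successive differences of `q : V → ℝ` vanish, that is, `q` has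
degree less than `k`. -/
def IsPolyDeg : ℕ → (V → ℝ) → Prop
  | 0, q => ∀ v, q v = 0
  | k + 1, q => ∀ h, IsPolyDeg k fun v => q (v + h) - q v

theorem IsPolyDeg.zero (k : ℕ) : IsPolyDeg k fun _ : V => (0 : ℝ) := by
  induction k with
  | zero => exact fun _ => rfl
  | succ k ih => exact fun h => by simpa using ih

theorem IsPolyDeg.comp_addHom {W : Type*} [AddCommGroup W] {k : ℕ} {q : V → ℝ}
    (hq : IsPolyDeg k q) (l : W →+ V) (v₀ : V) : IsPolyDeg k fun w => q (v₀ + l w) := by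
  induction k generalizing q with
  | zero => exact fun w => hq _
  | succ k ih =>
    intro h
    convert ih (hq (l h)) using 2
    simp only [map_add, add_assoc]

theorem IsPolyDeg.of_additive (l : V →+ ℝ) (k : ℕ) : IsPolyDeg (k + 2) fun v => l v := by
  intro h h'
  simpa using IsPolyDeg.zero k

/-- A one-parameter subgroup inside `Γ d`, evaluated at a polynomial of degree at most `d`, is a
polynomial map. -/
theorem IsPolyMap.curve_comp {d : ℕ} {e : ℝ → N} (hadd : ∀ t u, e (t + u) = e t * e u)
    (hmem : ∀ t, e t ∈ lcsFiltration N d) {q : V → ℝ} (k : ℕ) (hq : IsPolyDeg (d + 1) q) :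
    IsPolyMap k 0 fun v => e (q v) := by
  have h0 : e 0 = 1 := by simpa using hadd 0 0
  have hsub : ∀ t u, (e t)⁻¹ * e u = e (u - t) := fun t u => by
    rw [inv_mul_eq_iff_eq_mul, ← hadd]; congr 1; ring
  have key : ∀ k m i (q : V → ℝ), m + i = d + 1 → IsPolyDeg m q →
      IsPolyMap k i fun v => e (q v) := by
    intro k
    have htriv : ∀ k i (q : V → ℝ), (∀ v, q v = 0) → IsPolyMap k i fun v => e (q v) := by
      intro k
      induction k with
      | zero => exact fun i q hq v => by simp only [hq v, h0, one_mem]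
      | succ k ih =>
        refine fun i q hq => ⟨fun v => by simp only [hq v, h0, one_mem], fun h => ?_⟩
        simp only [hsub]
        exact ih _ _ fun v => by simp only [hq, sub_zero]
    induction k with
    | zero =>
      intro m i q hmi hq v
      rcases m with _ | m
      · exact htriv 0 i q hq v
      · exact lcsFiltration_antitone (by omega) (hmem (q v))
    | succ k ih =>
      intro m i q hmi hq
      rcases m with _ | m
      · exact htriv (k + 1) i q hq
      · refine ⟨fun v => lcsFiltration_antitone (by omega) (hmem (q v)), fun h => ?_⟩
        simp only [hsub]
        exact ih m (i + 1) _ (by omega) (hq h)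
  exact key k (d + 1) 0 q (by omega) hq

end PolyMap

/-! ### Continuous functions with vanishing differences are polynomials -/

section Frechet

open Polynomial in
/-- Along an arithmetic progression, a function with vanishing `k`-th differences is given by a
polynomial (the Gregory–Newton formula). -/
theorem IsPolyDeg.exists_polynomial_progression {k : ℕ} {f : ℝ → ℝ} (hf : IsPolyDeg k f)
    (y h : ℝ) : ∃ p : ℝ[X], p.degree < k ∧ ∀ n : ℕ, f (y + n * h) = p.eval (n : ℝ) := by
  have hz : ∀ (k : ℕ) (f : ℝ → ℝ), IsPolyDeg k f → ∀ j, (fwdDiff h)^[k + j] f = 0 := by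
    intro k
    induction k with
    | zero =>
      intro f hf j
      have : f = 0 := funext hf
      rw [this, zero_add]
      induction j with
      | zero => rfl
      | succ j ih => rw [Function.iterate_succ_apply', ih]; ext x; simp [fwdDiff]
    | succ k ih =>
      intro f hf j
      rw [show k + 1 + j = (k + j) + 1 by omega, Function.iterate_succ_apply]
      exact ih _ (hf h) j
  refine ⟨∑ i ∈ Finset.range k,
    C ((fwdDiff h)^[i] f y / (i.factorial : ℝ)) * descPochhammer ℝ i, ?_, fun n => ?_⟩
  · refine (Polynomial.degree_sum_le _ _).trans_lt ?_
    rw [Finset.sup_lt_iff (by exact WithBot.bot_lt_coe k)]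
    intro i hi
    rw [← Polynomial.smul_eq_C_mul]
    refine (Polynomial.degree_smul_le _ _).trans_lt ?_
    rw [Polynomial.degree_eq_natDegree (monic_descPochhammer ℝ i).ne_zero,
      descPochhammer_natDegree]
    exact_mod_cast Finset.mem_range.1 hi
  · have h1 := shift_eq_sum_fwdDiff_iter h f n y
    rw [nsmul_eq_mul] at h1
    rw [h1, Polynomial.eval_finsetSum]
    have hterm : ∀ i, (n.choose i) • (fwdDiff h)^[i] f y =
        eval (n : ℝ) (C ((fwdDiff h)^[i] f y / (i.factorial : ℝ)) * descPochhammer ℝ i) := by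
      intro i
      rw [nsmul_eq_mul, Nat.cast_choose_eq_descPochhammer_div, eval_mul, eval_C]
      ring
    simp only [hterm]
    -- Terms with `i ≥ k` vanish with the differences, terms with `i > n` with the binomials.
    rw [← Finset.sum_subset (Finset.range_mono (min_le_left (n + 1) k)),
      ← Finset.sum_subset (Finset.range_mono (min_le_right (n + 1) k))]
    · intro i hi hni
      rw [← hterm, Nat.choose_eq_zero_of_lt, zero_smul]
      simp only [Finset.mem_range] at hi hni
      omega
    · intro i hi hni
      simp only [Finset.mem_range] at hi hni
      obtain ⟨j, rfl⟩ : ∃ j, i = k + j := ⟨i - k, by omega⟩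
      rw [← hterm, hz k f hf j, Pi.zero_apply, smul_zero]

open Polynomial in
/-- Fréchet's theorem: a continuous real function whose `k`-th differences vanish is a polynomial
of degree less than `k`. -/
theorem IsPolyDeg.exists_polynomial {k : ℕ} {f : ℝ → ℝ} (hf : IsPolyDeg k f)
    (hc : Continuous f) : ∃ p : ℝ[X], p.degree < k ∧ ∀ x, f x = p.eval x := by
  obtain ⟨p, hp, hpf⟩ := hf.exists_polynomial_progression 0 1
  simp only [zero_add, mul_one] at hpf
  refine ⟨p, hp, ?_⟩
  have hrat : ∀ q : ℚ, f q = p.eval (q : ℝ) := by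
    intro q
    -- `q` lies on the progression of step `1 / N` that starts at the integer `-M`.
    set N : ℕ := q.den
    set M : ℕ := q.num.natAbs
    have hN : (N : ℝ) ≠ 0 := Nat.cast_ne_zero.2 q.den_ne_zero
    obtain ⟨r, -, hr⟩ := hf.exists_polynomial_progression (-(M : ℝ)) (1 / N)
    have heq : r.comp (C (N : ℝ) * (X + C (M : ℝ))) = p := by
      refine Polynomial.eq_of_infinite_eval_eq _ _
        ((Set.infinite_range_of_injective (Nat.cast_injective (R := ℝ))).mono ?_)
      rintro _ ⟨m, rfl⟩
      have h1 := hr (N * (m + M))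
      rw [Set.mem_ofPred_eq, ← hpf, eval_comp]
      simp only [eval_mul, eval_C, eval_add, eval_X]
      push_cast at h1
      rw [← h1]
      congr 1
      field_simp
      ring
    obtain ⟨n, hn⟩ : ∃ n : ℕ, (n : ℤ) = N * M + q.num := by
      refine ⟨(N * M + q.num).toNat, Int.toNat_of_nonneg ?_⟩
      have h1 : (1 : ℤ) ≤ N := by exact_mod_cast q.den_pos
      have h2 : -(M : ℤ) ≤ q.num := by omega
      have h3 : (0 : ℤ) ≤ M := by omega
      nlinarith
    have hn' : (n : ℝ) = N * M + q.num := by exact_mod_cast hn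
    have hq : (q : ℝ) = -(M : ℝ) + n * (1 / N) := by
      have : (q : ℝ) = q.num / N := by exact_mod_cast (Rat.num_div_den q).symm
      rw [this, hn']
      field_simp
      ring
    rw [hq, hr n, ← heq, eval_comp]
    simp only [eval_mul, eval_C, eval_add, eval_X]
    congr 1
    field_simp
    ring
  have : f = fun x => p.eval x :=
    Rat.denseRange_cast.equalizer hc p.continuous (funext hrat)
  exact fun x => congrFun this x

/-- Fréchet's theorem in several variables, by Lagrange interpolation in the first one. -/
theorem IsPolyDeg.exists_mvPolynomial {L k : ℕ} {f : (Fin L → ℝ) → ℝ} (hf : IsPolyDeg k f)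
    (hc : Continuous f) : ∃ p : MvPolynomial (Fin L) ℝ, ∀ x, f x = MvPolynomial.eval x p := by
  induction L with
  | zero =>
    refine ⟨MvPolynomial.C (f 0), fun x => ?_⟩
    rw [MvPolynomial.eval_C, Subsingleton.elim x 0]
  | succ L ih =>
    have hslice : ∀ t : ℝ, ∃ p : MvPolynomial (Fin L) ℝ,
        ∀ y, f (Fin.cons t y : Fin (L + 1) → ℝ) = MvPolynomial.eval y p := by
      intro t
      refine ih (f := fun y => f (Fin.cons t y : Fin (L + 1) → ℝ)) ?_
        (hc.comp (Continuous.finCons continuous_const continuous_id))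
      let l : (Fin L → ℝ) →+ (Fin (L + 1) → ℝ) :=
        { toFun := fun y => Fin.cons 0 y
          map_zero' := by ext i; refine Fin.cases ?_ (fun j => ?_) i <;> simp
          map_add' := fun y z => by ext i; refine Fin.cases ?_ (fun j => ?_) i <;> simp }
      convert hf.comp_addHom l (Fin.cons t 0) using 3 with y
      ext i; refine Fin.cases ?_ (fun j => ?_) i <;> simp [l]
    choose P hP using hslice
    let s := Finset.range k
    let v : ℕ → ℝ := fun i => i
    have hv : Set.InjOn v s := Nat.cast_injective.injOn
    refine ⟨∑ i ∈ s, Polynomial.aeval (MvPolynomial.X 0) (Lagrange.basis s v i) *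
      MvPolynomial.rename Fin.succ (P (v i)), fun x => ?_⟩
    have hx : x = Fin.cons (x 0) (Fin.tail x) := (Fin.cons_self_tail x).symm
    have hline : IsPolyDeg k fun t : ℝ => f (Fin.cons t (Fin.tail x) : Fin (L + 1) → ℝ) := by
      convert hf.comp_addHom (AddMonoidHom.single (fun _ : Fin (L + 1) => ℝ) 0)
        (Fin.cons 0 (Fin.tail x)) using 3 with t
      ext i; refine Fin.cases ?_ (fun j => ?_) i <;> simp
    obtain ⟨p, hp, hpf⟩ := hline.exists_polynomial
      (hc.comp (Continuous.finCons continuous_id continuous_const))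
    have hint := Lagrange.eq_interpolate hv (f := p) (by simpa [s] using hp)
    have hfx : f x = p.eval (x 0) := by rw [← hpf]; exact congrArg f hx
    rw [hfx, hint, Lagrange.interpolate_apply, Polynomial.eval_finsetSum, map_sum]
    refine Finset.sum_congr rfl fun i _ => ?_
    rw [Polynomial.eval_mul, Polynomial.eval_C, map_mul, MvPolynomial.eval_rename, ← hpf, hP,
      mul_comm]
    congr 1
    rw [Polynomial.aeval_def, Polynomial.hom_eval₂, MvPolynomial.eval_X, Polynomial.eval₂_eq_eval_map]
    congr 1
    ext n
    simp

end Frechet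

/-! ### Null sets and polynomial maps -/

section NullSets

theorem MvPolynomial.hasStrictFDerivAt_eval {L : ℕ} (p : MvPolynomial (Fin L) ℝ)
    (x : Fin L → ℝ) : HasStrictFDerivAt (fun x => MvPolynomial.eval x p)
      (∑ i, MvPolynomial.eval x (MvPolynomial.pderiv i p) •
        ContinuousLinearMap.proj (R := ℝ) (φ := fun _ : Fin L => ℝ) i) x := by
  induction p using MvPolynomial.induction_on with
  | C a => simpa using hasStrictFDerivAt_const a x
  | add p q hp hq =>
    have h := (hp.add hq).congr_fderiv (g' := ∑ i, MvPolynomial.eval x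
      (MvPolynomial.pderiv i (p + q)) •
        ContinuousLinearMap.proj (R := ℝ) (φ := fun _ : Fin L => ℝ) i)
      (by simp [add_smul, Finset.sum_add_distrib])
    refine h.congr_of_eventuallyEq (Filter.Eventually.of_forall fun y => ?_)
    simp
  | mul_X p n hp =>
    have h := (hp.mul (ContinuousLinearMap.proj (R := ℝ) (φ := fun _ : Fin L => ℝ)
      n).hasStrictFDerivAt).congr_fderiv (g' := ∑ i, MvPolynomial.eval x
      (MvPolynomial.pderiv i (p * MvPolynomial.X n)) •
        ContinuousLinearMap.proj (R := ℝ) (φ := fun _ : Fin L => ℝ) i) (by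
        ext v
        simp [MvPolynomial.pderiv_X, Pi.single_apply, Finset.mul_sum, mul_comm, apply_ite]
        simp [mul_add, Finset.sum_add_distrib, mul_left_comm])
    refine h.congr_of_eventuallyEq (Filter.Eventually.of_forall fun y => ?_)
    simp

/-- The zero set of a nonzero polynomial has measure zero. -/
theorem MvPolynomial.ae_eval_ne_zero {L : ℕ} {p : MvPolynomial (Fin L) ℝ} (hp : p ≠ 0) :
    ∀ᵐ x : Fin L → ℝ, MvPolynomial.eval x p ≠ 0 := by
  induction L with
  | zero =>
    refine Filter.Eventually.of_forall fun x hx => hp ?_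
    refine MvPolynomial.funext fun y => ?_
    rw [Subsingleton.elim y x, hx, map_zero]
  | succ L ih =>
    set q := MvPolynomial.finSuccEquiv ℝ L p with hq
    have hq0 : q ≠ 0 := by simpa [hq] using hp
    obtain ⟨m, hm⟩ : ∃ m, q.coeff m ≠ 0 := by
      by_contra! h
      exact hq0 (Polynomial.ext fun m => by simpa using h m)
    have hmeas : MeasurableSet {x : Fin (L + 1) → ℝ | MvPolynomial.eval x p = 0} :=
      (isClosed_singleton.preimage (MvPolynomial.continuous_eval p)).measurableSet
    have hpre := volume_preserving_piFinSuccAbove (fun _ : Fin (L + 1) => ℝ) 0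
    rw [ae_iff]
    simp only [not_not]
    rw [← hpre.symm.measure_preimage hmeas.nullMeasurableSet]
    have hmeas' := hpre.symm.measurable hmeas
    rw [Measure.volume_eq_prod, ← Measure.prod_swap,
      Measure.map_apply measurable_swap hmeas',
      Measure.measure_prod_null (measurable_swap hmeas')]
    filter_upwards [ih hm] with y hy
    have hne : Polynomial.map (MvPolynomial.eval y) q ≠ 0 := fun h0 => hy (by
      have := congrArg (fun r => Polynomial.coeff r m) h0
      simpa [Polynomial.coeff_map] using this)
    refine measure_mono_null ?_
      ((Polynomial.map (MvPolynomial.eval y) q).roots.toFinset.finite_toSet.measure_zero volume)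
    intro t ht
    have ht' : MvPolynomial.eval (Fin.cons t y : Fin (L + 1) → ℝ) p = 0 := by
      simpa [MeasurableEquiv.piFinSuccAbove, Fin.insertNthEquiv] using ht
    rw [MvPolynomial.eval_eq_eval_mv_eval'] at ht'
    simpa [hne] using ht'

variable {E F : Type*} [NormedAddCommGroup E] [NormedSpace ℝ E] [FiniteDimensional ℝ E]
  [MeasurableSpace E] [BorelSpace E] [NormedAddCommGroup F] [NormedSpace ℝ F]
  [FiniteDimensional ℝ F] [MeasurableSpace F] [BorelSpace F]
  (μ : Measure E) [μ.IsAddHaarMeasure] (ν : Measure F) [ν.IsAddHaarMeasure]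

/-- Near a point where its derivative is onto, a map pulls null sets back to null sets. -/
theorem exists_mem_nhds_preimage_null_of_surjective {f : E → F} {f' : E →L[ℝ] F} {a : E}
    (hf : HasStrictFDerivAt f f' a) (hf' : Function.Surjective f') {s : Set F} (hs : ν s = 0) :
    ∃ u ∈ nhds a, μ (u ∩ f ⁻¹' s) = 0 := by
  obtain ⟨σ, hσ⟩ := f'.toLinearMap.exists_rightInverse_of_surjective
    (LinearMap.range_eq_top.2 hf')
  have hσ' : ∀ y, f' (σ y) = y := fun y => LinearMap.congr_fun hσ y
  let τ : F →L[ℝ] E := LinearMap.toContinuousLinearMap σ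
  have hτ : ∀ y, f' (τ y) = y := hσ'
  -- `q` straightens `f`: its derivative at `a` is the identity, and `f = f' ∘ q`.
  let q : E → E := fun x => τ (f x) + (x - τ (f' x))
  have hq : HasStrictFDerivAt q (ContinuousLinearMap.id ℝ E) a := by
    have h1 := (τ.hasStrictFDerivAt.comp a hf).add
      ((hasStrictFDerivAt_id a).sub (τ.comp f').hasStrictFDerivAt)
    exact h1.congr_fderiv (by ext x; simp)
  have hfq : ∀ x, f' (q x) = f x := fun x => by simp [q, hτ]
  have hdet : ((1 / 2 : NNReal) : ENNReal) <
      ENNReal.ofReal |(ContinuousLinearMap.id ℝ E).det| := by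
    simp [ContinuousLinearMap.det]
  obtain ⟨δ, hδ, hδ0⟩ := ((mul_le_addHaar_image_of_lt_det μ _ hdet).and
    self_mem_nhdsWithin).exists
  obtain ⟨u, hu, hqu⟩ := hq.approximates_deriv_on_nhds (Or.inr hδ0)
  refine ⟨u, hu, ?_⟩
  have h1 := hδ (u ∩ f ⁻¹' s) q (hqu.mono_set Set.inter_subset_left)
  have h2 : μ (f' ⁻¹' (toMeasurable ν s)) = 0 := by
    have h3 := ae_comp_linearMap_mem_iff f'.toLinearMap μ ν hf'
      (measurableSet_toMeasurable ν s).compl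
    have h4 : ∀ᵐ y ∂ν, y ∈ (toMeasurable ν s)ᶜ := by
      rw [ae_iff]
      simpa [measure_toMeasurable] using hs
    have h5 := h3.2 h4
    rw [ae_iff] at h5
    simp only [Set.mem_compl_iff, not_not] at h5
    exact h5
  have h3 : μ (q '' (u ∩ f ⁻¹' s)) = 0 := by
    refine measure_mono_null ?_ h2
    rintro _ ⟨x, ⟨-, hx⟩, rfl⟩
    rw [Set.mem_preimage, hfq]
    exact subset_toMeasurable ν s hx
  rw [h3, nonpos_iff_eq_zero, mul_eq_zero] at h1
  exact h1.resolve_left (by simp)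

/-- A map whose derivative is onto almost everywhere pulls null sets back to null sets. -/
theorem preimage_null_of_ae_surjective {f : E → F} {f' : E → E →L[ℝ] F}
    (hf : ∀ x, HasStrictFDerivAt f (f' x) x) (hf' : ∀ᵐ x ∂μ, Function.Surjective (f' x))
    {s : Set F} (hs : ν s = 0) : μ (f ⁻¹' s) = 0 := by
  have h1 : μ (f ⁻¹' s ∩ {x | Function.Surjective (f' x)}) = 0 := by
    refine measure_null_of_locally_null _ fun x hx => ?_
    obtain ⟨u, hu, hu0⟩ := exists_mem_nhds_preimage_null_of_surjective μ ν (hf x) hx.2 hs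
    refine ⟨_, ?_, hu0⟩
    rw [mem_nhdsWithin_iff_exists_mem_nhds_inter]
    exact ⟨u, hu, fun y hy => ⟨hy.1, hy.2.1⟩⟩
  refine measure_mono_null (fun x hx => ?_) (measure_union_null h1 (ae_iff.1 hf'))
  by_cases h : Function.Surjective (f' x)
  · exact Or.inl ⟨hx, h⟩
  · exact Or.inr h

/-- A polynomial map whose derivative is onto at one point pulls null sets back to null sets: the
Gram determinant of its Jacobian matrix is a polynomial that does not vanish identically. -/
theorem preimage_null_of_polynomial {L n : ℕ} {f : (Fin L → ℝ) → Fin n → ℝ}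
    (P : Fin n → MvPolynomial (Fin L) ℝ) (hP : ∀ x j, f x j = MvPolynomial.eval x (P j))
    {x₀ : Fin L → ℝ} {f₀ : (Fin L → ℝ) →L[ℝ] Fin n → ℝ} (hf₀ : HasFDerivAt f f₀ x₀)
    (hsurj : Function.Surjective f₀) {s : Set (Fin n → ℝ)} (hs : volume s = 0) :
    volume (f ⁻¹' s) = 0 := by
  let J : Matrix (Fin n) (Fin L) (MvPolynomial (Fin L) ℝ) :=
    Matrix.of fun j i => MvPolynomial.pderiv i (P j)
  let Jx : (Fin L → ℝ) → Matrix (Fin n) (Fin L) ℝ := fun x => J.map (MvPolynomial.eval x)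
  let f' : (Fin L → ℝ) → (Fin L → ℝ) →L[ℝ] Fin n → ℝ := fun x =>
    LinearMap.toContinuousLinearMap (Jx x).mulVecLin
  have hf : ∀ x, HasStrictFDerivAt f (f' x) x := by
    intro x
    rw [hasStrictFDerivAt_pi']
    intro j
    have h1 := (P j).hasStrictFDerivAt_eval x
    have h2 : (fun y => f y j) = fun y => MvPolynomial.eval y (P j) := funext fun y => hP y j
    rw [h2]
    refine h1.congr_fderiv ?_
    ext v
    simp [f', Jx, J, Matrix.mulVec, dotProduct]
  let g : MvPolynomial (Fin L) ℝ := (J * J.transpose).det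
  have hg : ∀ x, MvPolynomial.eval x g = (Jx x * (Jx x).transpose).det := fun x => by
    rw [RingHom.map_det, RingHom.mapMatrix_apply, Matrix.map_mul, Matrix.transpose_map]
  have hiff : ∀ x, Function.Surjective (f' x) ↔ MvPolynomial.eval x g ≠ 0 := by
    intro x
    have h1 : Function.Surjective (f' x) ↔ (Jx x).rank = n := by
      constructor
      · intro h
        have h' : (Jx x).mulVecLin.range = ⊤ := LinearMap.range_eq_top.2 h
        rw [Matrix.rank, h', finrank_top]
        simp
      · intro h
        have h' : (Jx x).mulVecLin.range = ⊤ :=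
          Submodule.eq_top_of_finrank_eq (by rw [← Matrix.rank, h]; simp)
        exact LinearMap.range_eq_top.1 h'
    rw [h1, hg, ← Matrix.rank_self_mul_transpose, ← isUnit_iff_ne_zero,
      ← Matrix.isUnit_iff_isUnit_det]
    constructor
    · intro h
      rw [← Matrix.linearIndependent_rows_iff_isUnit, linearIndependent_iff_card_eq_finrank_span,
        Set.finrank, ← Matrix.rank_eq_finrank_span_row, h, Fintype.card_fin]
    · intro h
      rw [Matrix.rank_of_isUnit _ h, Fintype.card_fin]
  have hg0 : g ≠ 0 := by
    rintro h0
    refine (hiff x₀).1 ?_ (by rw [h0, map_zero])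
    rwa [← hf₀.unique (hf x₀).hasFDerivAt]
  refine preimage_null_of_ae_surjective volume volume hf ?_ hs
  filter_upwards [MvPolynomial.ae_eval_ne_zero hg0] with x hx
  exact (hiff x).2 hx

end NullSets

/-! ### Lifting homogeneous curves through a central layer -/

namespace ScalableGroup

open Topology Filter

section Lift

variable {G Q : Type*} [Group G] [TopologicalSpace G] [IsTopologicalGroup G] [ScalableGroup G]
  [Group Q] [TopologicalSpace Q] [IsTopologicalGroup Q] [ScalableGroup Q]

/-- An injective continuous map from `ℝ^k` that intertwines the dilations with a homogeneous
dilation of `ℝ^k` is a closed embedding: if `φ(u) → y` with `u → ∞`, rescaling to the unit sphere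
shows that `φ` takes the value `1 = δ_0 y` on the sphere. -/
theorem isClosedEmbedding_of_homogeneous [T2Space G] {k d : ℕ} (hd : d ≠ 0)
    {φ : (Fin k → ℝ) → G} (hφ : Continuous φ) (hinj : Function.Injective φ) (h0 : φ 0 = 1)
    (hdil : ∀ (t : ℝ) u, dil t (φ u) = φ (t ^ d • u)) : IsClosedEmbedding φ := by
  refine .of_continuous_injective_isClosedMap hφ hinj (IsProperMap.isClosedMap ?_)
  rw [isProperMap_iff_ultrafilter_of_t2]
  refine ⟨hφ, fun 𝒰 y hy => ?_⟩
  by_cases hU : (𝒰 : Filter (Fin k → ℝ)) ≤ cocompact _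
  · exfalso
    let l : (Fin k → ℝ) → ℝ := fun u => (‖u‖⁻¹) ^ ((d : ℝ)⁻¹)
    have hl : Tendsto l 𝒰 (𝓝 0) := by
      have h1 : Tendsto (fun u : Fin k → ℝ => ‖u‖⁻¹) 𝒰 (𝓝 0) :=
        tendsto_inv_atTop_zero.comp ((tendsto_norm_cocompact_atTop (E := Fin k → ℝ)).mono_left hU)
      have hd' : (0 : ℝ) < (d : ℝ)⁻¹ := by positivity
      have h2 := h1.rpow_const (p := (d : ℝ)⁻¹) (Or.inr hd'.le)
      rwa [Real.zero_rpow hd'.ne'] at h2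
    have hlim : Tendsto (fun u => dil (l u) (φ u)) 𝒰 (𝓝 1) := by
      have h1 := ((continuous_dil (G := G)).tendsto (0, y)).comp (hl.prodMk_nhds hy)
      simpa [dil_zero, Function.comp_def] using h1
    have hcl : IsClosed (φ '' Metric.sphere 0 1) :=
      ((isCompact_sphere (0 : Fin k → ℝ) 1).image hφ).isClosed
    have hmem : (1 : G) ∈ φ '' Metric.sphere 0 1 := by
      refine hcl.mem_of_tendsto hlim ?_
      have hne : {(0 : Fin k → ℝ)}ᶜ ∈ (𝒰 : Filter (Fin k → ℝ)) :=
        hU isCompact_singleton.compl_mem_cocompact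
      filter_upwards [hne] with u hu
      have hu' : ‖u‖ ≠ 0 := norm_ne_zero_iff.2 hu
      rw [hdil]
      refine ⟨_, ?_, rfl⟩
      have : l u ^ d = ‖u‖⁻¹ := Real.rpow_inv_natCast_pow (by positivity) hd
      rw [this, mem_sphere_zero_iff_norm, norm_smul, norm_inv, norm_norm, inv_mul_cancel₀ hu']
    obtain ⟨u, hu, hu1⟩ := hmem
    have : u = 0 := hinj (hu1.trans h0.symm)
    simp [this] at hu
  · obtain ⟨K, hK, hK'⟩ : ∃ K : Set (Fin k → ℝ), IsCompact K ∧ Kᶜ ∉ 𝒰 := by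
      by_contra! h
      refine hU ((hasBasis_cocompact).ge_iff.2 fun K hK => h K hK)
    have hK'' : K ∈ 𝒰 := by
      by_contra h
      exact hK' (Ultrafilter.compl_mem_iff_notMem.2 h)
    obtain ⟨x, -, hx⟩ := isCompact_iff_ultrafilter_le_nhds'.1 hK 𝒰 hK''
    exact ⟨x, hx⟩

/-- A central extension `ℝ^k → G → Q` of scalable groups, in which `ℝ^k` lies in the term `lcs s`
of the lower central series of `G` and is dilated homogeneously of degree `s + 1`. -/
structure CentralLayer (G Q : Type*) [Group G] [TopologicalSpace G] [IsTopologicalGroup G]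
    [ScalableGroup G] [Group Q] [TopologicalSpace Q] [IsTopologicalGroup Q] [ScalableGroup Q]
    (s k : ℕ) where
  /-- The projection `G → Q`. -/
  proj : G →* Q
  isOpenQuotientMap : IsOpenQuotientMap proj
  proj_dil : ∀ t g, proj (dil t g) = dil t (proj g)
  /-- The inclusion of the kernel `ℝ^k`. -/
  incl : (Fin k → ℝ) → G
  incl_add : ∀ u v, incl (u + v) = incl u * incl v
  isClosedEmbedding : IsClosedEmbedding incl
  dil_incl : ∀ (t : ℝ) u, dil t (incl u) = incl (t ^ (s + 1) • u)
  incl_comm : ∀ u g, incl u * g = g * incl u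
  proj_eq_one_iff : ∀ g, proj g = 1 ↔ g ∈ Set.range incl
  incl_mem : ∀ u, incl u ∈ (⊤ : Subgroup G).lowerCentralSeries s

namespace CentralLayer

variable {s k : ℕ} (Z : CentralLayer G Q s k)

/-- The inclusion of `ℝ^k` as a homomorphism. -/
def inclHom : Multiplicative (Fin k → ℝ) →* G :=
  MonoidHom.mk' (fun u => Z.incl u.toAdd) fun u v => Z.incl_add u.toAdd v.toAdd

theorem incl_zero : Z.incl 0 = 1 := map_one Z.inclHom

theorem incl_neg (u) : Z.incl (-u) = (Z.incl u)⁻¹ := map_inv Z.inclHom (Multiplicative.ofAdd u)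

theorem incl_nsmul (n : ℕ) (u) : Z.incl (n • u) = Z.incl u ^ n :=
  map_pow Z.inclHom (Multiplicative.ofAdd u) n

theorem proj_incl (u) : Z.proj (Z.incl u) = 1 := (Z.proj_eq_one_iff _).2 ⟨u, rfl⟩

theorem exists_mul_incl {g h : G} (e : Z.proj g = Z.proj h) : ∃ u, h = g * Z.incl u := by
  obtain ⟨u, hu⟩ := (Z.proj_eq_one_iff (g⁻¹ * h)).1 (by rw [map_mul, map_inv, e, inv_mul_cancel])
  exact ⟨u, by rw [hu, mul_inv_cancel_left]⟩

/-- In the fibre over a point `q` with `δ_2 q = q ^ (2 ^ d)`, `d ≤ s`, exactly one point has the same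
property: on the fibre direction `δ_2` acts by `2 ^ (s + 1)`, and `2 ^ (s + 1) ≠ 2 ^ d`. -/
theorem existsUnique_homogeneous_lift {d : ℕ} (hd : d ≤ s) {q : Q} (hq : dil 2 q = q ^ 2 ^ d) :
    ∃! x : G, Z.proj x = q ∧ dil 2 x = x ^ 2 ^ d := by
  have hne : (2 : ℝ) ^ (s + 1) - 2 ^ d ≠ 0 := by
    rw [sub_ne_zero]
    exact (pow_right_injective₀ (by norm_num) (by norm_num)).ne (by omega)
  have key : ∀ (y : G) (c : Fin k → ℝ), (y * Z.incl c) ^ 2 ^ d =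
      y ^ 2 ^ d * Z.incl ((2 : ℝ) ^ d • c) := by
    intro y c
    have : Commute y (Z.incl c) := (Z.incl_comm c y).symm
    rw [this.mul_pow, ← Z.incl_nsmul, ← Nat.cast_smul_eq_nsmul ℝ]
    norm_num
  obtain ⟨y, rfl⟩ := Z.isOpenQuotientMap.surjective q
  obtain ⟨ζ, hζ⟩ := Z.exists_mul_incl (g := y ^ 2 ^ d) (h := dil 2 y)
    (by rw [map_pow, Z.proj_dil, hq])
  have hc : ∀ c : Fin k → ℝ, dil 2 (y * Z.incl c) = (y * Z.incl c) ^ 2 ^ d ↔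
      ζ + ((2 : ℝ) ^ (s + 1) - 2 ^ d) • c = 0 := by
    intro c
    rw [dil_mul, hζ, key, Z.dil_incl, mul_assoc, ← Z.incl_add, mul_right_inj,
      Z.isClosedEmbedding.injective.eq_iff, sub_smul, ← add_sub_assoc, sub_eq_zero]
  refine ⟨y * Z.incl (-((2 : ℝ) ^ (s + 1) - 2 ^ d)⁻¹ • ζ), ⟨?_, ?_⟩, ?_⟩
  · rw [map_mul, Z.proj_incl, mul_one]
  · rw [hc, neg_smul, smul_neg, smul_inv_smul₀ hne, add_neg_cancel]
  · rintro x ⟨hx, hx2⟩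
    obtain ⟨c, rfl⟩ := Z.exists_mul_incl hx.symm
    rw [hc] at hx2
    congr 2
    rw [neg_smul, eq_neg_iff_add_eq_zero, ← smul_right_injective _ hne |>.eq_iff]
    simp only [smul_add, smul_inv_smul₀ hne, smul_zero]
    rw [add_comm, hx2]

/-- The preimage of a one-parameter subgroup under a central extension is commutative. -/
theorem commute_of_proj_eq_curve [T2Space G] {c : ℝ → Q} (hc : Continuous c)
    (hadd : ∀ t u, c (t + u) = c t * c u) {x y : G} {t u : ℝ} (hx : Z.proj x = c t)
    (hy : Z.proj y = c u) : x * y = y * x := by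
  have hc0 : c 0 = 1 := by simpa using hadd 0 0
  let cHom : Multiplicative ℝ →* Q := MonoidHom.mk' (fun r => c r.toAdd) fun r r' => hadd _ _
  have hnsmul : ∀ (n : ℕ) r, c (n * r) = c r ^ n := fun n r => by
    have := map_pow cHom (Multiplicative.ofAdd r) n
    rwa [← ofAdd_nsmul, nsmul_eq_mul] at this
  have hneg : ∀ r, c (-r) = (c r)⁻¹ := fun r => map_inv cHom (Multiplicative.ofAdd r)
  -- The image of the centralizer of `x` is closed, as the centralizer contains the kernel.
  let A : Set Q := {q | ∃ g, Z.proj g = q ∧ x * g = g * x}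
  have hA : ∀ g, Z.proj g ∈ A ↔ x * g = g * x := by
    refine fun g => ⟨?_, fun h => ⟨g, rfl, h⟩⟩
    rintro ⟨g', hg', h⟩
    obtain ⟨v, rfl⟩ := Z.exists_mul_incl hg'
    rw [← mul_assoc, h, mul_assoc, ← Z.incl_comm, ← mul_assoc]
  have hAcl : IsClosed A := by
    rw [← Z.isOpenQuotientMap.isQuotientMap.isClosed_preimage]
    have : Z.proj ⁻¹' A = {g | x * g = g * x} := Set.ext fun g => hA g
    rw [this]
    exact isClosed_eq (by fun_prop) (by fun_prop)
  have hApow : ∀ {q : Q} (n : ℕ), q ∈ A → q ^ n ∈ A := by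
    rintro _ n ⟨g, rfl, h⟩
    exact ⟨g ^ n, map_pow _ _ _, (Commute.pow_right (show Commute x g from h) n).eq⟩
  have hAinv : ∀ {q : Q}, q ∈ A → q⁻¹ ∈ A := by
    rintro _ ⟨g, rfl, h⟩
    exact ⟨g⁻¹, map_inv _ _, (Commute.inv_right (show Commute x g from h)).eq⟩
  have hdiv : ∀ n : ℕ, n ≠ 0 → c (t / n) ∈ A := by
    intro n hn
    obtain ⟨g, hg⟩ := Z.isOpenQuotientMap.surjective (c (t / n))
    obtain ⟨v, hv⟩ := Z.exists_mul_incl (g := g ^ n) (h := x) (by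
      rw [map_pow, hg, hx, ← hnsmul]
      congr 1
      field_simp)
    refine ⟨g, hg, ?_⟩
    rw [hv]
    have h1 : Commute (g ^ n) g := (Commute.refl g).pow_left n
    exact (h1.mul_left (Z.incl_comm v g)).eq
  have hrat : ∀ q : ℚ, c (q * t) ∈ A := by
    intro q
    have h1 : (q : ℝ) * t = q.num * (t / q.den) := by
      have : (q : ℝ) = q.num / q.den := by exact_mod_cast (Rat.num_div_den q).symm
      rw [this]; ring
    obtain ⟨n, hn | hn⟩ := Int.eq_nat_or_neg q.num
    · rw [h1, hn, Int.cast_natCast, hnsmul]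
      exact hApow n (hdiv _ q.den_ne_zero)
    · rw [h1, hn, Int.cast_neg, Int.cast_natCast, neg_mul, hneg, hnsmul]
      exact hAinv (hApow n (hdiv _ q.den_ne_zero))
  have hall : ∀ r : ℝ, c (r * t) ∈ A := by
    have hcl : IsClosed {r : ℝ | c (r * t) ∈ A} := hAcl.preimage (by fun_prop)
    intro r
    exact closure_minimal (s := Set.range ((↑) : ℚ → ℝ)) (by rintro _ ⟨q, rfl⟩; exact hrat q) hcl
      (Rat.denseRange_cast r)
  rcases eq_or_ne t 0 with rfl | ht
  · obtain ⟨v, rfl⟩ := (Z.proj_eq_one_iff x).1 (hx.trans hc0)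
    exact Z.incl_comm v y
  · rw [← hA, hy]
    have := hall (u / t)
    rwa [div_mul_cancel₀ _ ht] at this

/-- A homogeneous one-parameter subgroup of degree `d ≤ s` lifts to one of the same degree. -/
theorem exists_curve_lift [T2Space G] {d : ℕ} (hd : d ≠ 0) (hds : d ≤ s) {c : ℝ → Q}
    (hc : Continuous c) (hadd : ∀ t u, c (t + u) = c t * c u)
    (hdil : ∀ (l t : ℝ), dil l (c t) = c (l ^ d * t)) :
    ∃ e : ℝ → G, Continuous e ∧ (∀ t u, e (t + u) = e t * e u) ∧
      (∀ l t : ℝ, dil l (e t) = e (l ^ d * t)) ∧ ∀ t, Z.proj (e t) = c t := by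
  have hpow : ∀ t, dil 2 (c t) = c t ^ 2 ^ d := by
    intro t
    let cHom : Multiplicative ℝ →* Q := MonoidHom.mk' (fun r => c r.toAdd) fun r r' => hadd _ _
    have := map_pow cHom (Multiplicative.ofAdd t) (2 ^ d)
    rw [← ofAdd_nsmul, nsmul_eq_mul] at this
    rw [hdil]
    exact_mod_cast this
  have hex := fun t => Z.existsUnique_homogeneous_lift hds (hpow t)
  choose e he huniq using hex
  have headd : ∀ t u, e (t + u) = e t * e u := by
    intro t u
    refine (huniq _ _ ⟨by rw [map_mul, (he t).1, (he u).1, hadd], ?_⟩).symm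
    have hcomm : Commute (e t) (e u) := Z.commute_of_proj_eq_curve hc hadd (he t).1 (he u).1
    rw [dil_mul, (he t).2, (he u).2, hcomm.mul_pow]
  have hedil : ∀ l t : ℝ, dil l (e t) = e (l ^ d * t) := by
    intro l t
    refine huniq _ _ ⟨by rw [Z.proj_dil, (he t).1, hdil], ?_⟩
    rw [dil_dil, mul_comm, ← dil_dil, (he t).2, dil_pow]
  refine ⟨e, ?_, headd, hedil, fun t => (he t).1⟩
  have he0 : e 0 = 1 := by simpa using headd 0 0
  have hneg : ∀ t, e (-t) = (e t)⁻¹ := fun t => by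
    rw [eq_inv_iff_mul_eq_one, ← headd, neg_add_cancel, he0]
  -- Homogeneity expresses `e` through continuous functions and the point `e 1`.
  have hform : e = fun t : ℝ => dil ((max t 0) ^ ((d : ℝ)⁻¹)) (e 1) *
      (dil ((max (-t) 0) ^ ((d : ℝ)⁻¹)) (e 1))⁻¹ := by
    have hr : ∀ r : ℝ, 0 ≤ r → dil (r ^ ((d : ℝ)⁻¹)) (e 1) = e r := fun r hr => by
      rw [hedil, Real.rpow_inv_natCast_pow hr hd, mul_one]
    ext t
    rw [hr _ (le_max_right _ _), hr _ (le_max_right _ _), ← hneg, ← headd]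
    congr 1
    rcases le_total t 0 with h | h
    · rw [max_eq_right h, max_eq_left (by linarith)]; ring
    · rw [max_eq_left h, max_eq_right (by linarith)]; ring
  have hroot : Continuous fun r : ℝ => r ^ ((d : ℝ)⁻¹) :=
    Real.continuous_rpow_const (by positivity)
  rw [hform]
  exact (Continuous.dil (hroot.comp (by fun_prop)) continuous_const).mul
    (Continuous.dil (hroot.comp (by fun_prop)) continuous_const).inv

end CentralLayer

end Lift

end ScalableGroup

/-! ### Word maps -/

theorem continuous_list_prod_ofFn {G X : Type*} [Group G] [TopologicalSpace G]
    [IsTopologicalGroup G] [TopologicalSpace X] {n : ℕ}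
    {f : Fin n → X → G} (hf : ∀ j, Continuous (f j)) :
    Continuous fun x => (List.ofFn fun j => f j x).prod := by
  induction n with
  | zero => simpa using continuous_const
  | succ n ih =>
    simp only [List.ofFn_succ, List.prod_cons]
    exact (hf 0).mul (ih fun j => hf j.succ)

namespace ScalableGroup

open Topology Filter

section Words

variable {G Q : Type*} [Group G] [TopologicalSpace G] [IsTopologicalGroup G] [ScalableGroup G]
  [Group Q] [TopologicalSpace Q] [IsTopologicalGroup Q] [ScalableGroup Q] {ι : Type*}

/-- The product `δ_{t_0}(a_{w_0}) ⋯ δ_{t_{L-1}}(a_{w_{L-1}})` attached to a word `w` in the indices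
of the points `a`. -/
def wordMap (a : ι → G) {L : ℕ} (w : Fin L → ι) (t : Fin L → ℝ) : G :=
  (List.ofFn fun j => dil (t j) (a (w j))).prod

theorem wordMap_append (a : ι → G) {L M : ℕ} (w : Fin L → ι) (w' : Fin M → ι) (t : Fin L → ℝ)
    (t' : Fin M → ℝ) : wordMap a (Fin.append w w') (Fin.append t t') =
      wordMap a w t * wordMap a w' t' := by
  simp only [wordMap]
  rw [← List.prod_append, ← List.ofFn_fin_append]
  congr 2
  ext j
  refine Fin.addCases (fun j => ?_) (fun j => ?_) j <;> simp

theorem wordMap_cons (a : ι → G) {L : ℕ} (w : Fin (L + 1) → ι) (t : Fin (L + 1) → ℝ) :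
    wordMap a w t = dil (t 0) (a (w 0)) * wordMap a (Fin.tail w) (Fin.tail t) := by
  simp only [wordMap, List.ofFn_succ, List.prod_cons]
  rfl

theorem continuous_wordMap (a : ι → G) {L : ℕ} (w : Fin L → ι) : Continuous (wordMap a w) :=
  continuous_list_prod_ofFn fun j => Continuous.dil (continuous_apply j) continuous_const

theorem isPolyMap_wordMap {a : ι → G} (ha : ∀ i, a i ∈ firstLayer G) {L : ℕ} (w : Fin L → ι)
    (k : ℕ) : IsPolyMap k 0 (wordMap a w) := by
  refine IsPolyMap.list_prod fun j => ?_
  refine IsPolyMap.curve_comp (d := 1) (e := fun t => dil t (a (w j))) (ha (w j))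
    (fun _ => Subgroup.mem_top _) k ?_
  exact IsPolyDeg.of_additive (Pi.evalAddMonoidHom (fun _ : Fin L => ℝ) j) 0

variable (X : Type*) [NormedAddCommGroup X] [NormedSpace ℝ X] {Y : Type*} [NormedAddCommGroup Y]
  [NormedSpace ℝ Y]

/-- The maps `X → G` that are products of factors `x ↦ δ_{α(x)}(a_i)` with `α` differentiable, and
of inverses of such factors. -/
def wordMaps (a : ι → G) : Subgroup (X → G) :=
  Subgroup.closure {F | ∃ (i : ι) (α : X → ℝ), Differentiable ℝ α ∧ F = fun x => dil (α x) (a i)}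

variable {X} {a : ι → G}

theorem dil_mem_wordMaps (i : ι) {α : X → ℝ} (hα : Differentiable ℝ α) :
    (fun x => dil (α x) (a i)) ∈ wordMaps X a :=
  Subgroup.subset_closure ⟨i, α, hα, rfl⟩

theorem comp_mem_wordMaps {F : X → G} (hF : F ∈ wordMaps X a) {g : Y → X}
    (hg : Differentiable ℝ g) : F ∘ g ∈ wordMaps Y a := by
  induction hF using Subgroup.closure_induction with
  | mem F hF =>
    obtain ⟨i, α, hα, rfl⟩ := hF
    exact dil_mem_wordMaps i (hα.comp hg)
  | one => exact one_mem _
  | mul F F' _ _ h h' => exact mul_mem h h'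
  | inv F _ h => exact inv_mem h

theorem const_mem_wordMaps (hgen : Subgroup.closure {x : G | ∃ i, ∃ t : ℝ, x = dil t (a i)} = ⊤)
    (x : G) : (fun _ : X => x) ∈ wordMaps X a := by
  have hx : x ∈ Subgroup.closure {x : G | ∃ i, ∃ t : ℝ, x = dil t (a i)} :=
    hgen ▸ Subgroup.mem_top x
  induction hx using Subgroup.closure_induction with
  | mem x hx =>
    obtain ⟨i, t, rfl⟩ := hx
    exact dil_mem_wordMaps i (differentiable_const t)
  | one => exact one_mem _
  | mul x y _ _ h h' => exact mul_mem h h'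
  | inv x _ h => exact inv_mem h

/-- Word maps into a quotient lift to word maps: lift each letter. -/
theorem exists_lift_mem_wordMaps {π : G →* Q} (hπ : ∀ t g, π (dil t g) = dil t (π g)) {F : X → Q}
    (hF : F ∈ wordMaps X (π ∘ a)) : ∃ F' ∈ wordMaps X a, ∀ x, π (F' x) = F x := by
  induction hF using Subgroup.closure_induction with
  | mem F hF =>
    obtain ⟨i, α, hα, rfl⟩ := hF
    exact ⟨_, dil_mem_wordMaps i hα, fun x => hπ _ _⟩
  | one => exact ⟨1, one_mem _, fun x => map_one π⟩
  | mul F F' _ _ h h' =>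
    obtain ⟨H, hH, h⟩ := h
    obtain ⟨H', hH', h'⟩ := h'
    exact ⟨H * H', mul_mem hH hH', fun x => by simp [h, h']⟩
  | inv F _ h =>
    obtain ⟨H, hH, h⟩ := h
    exact ⟨H⁻¹, inv_mem hH, fun x => by simp [h]⟩

/-- A word map factors through a single word with differentiable exponents; inverse letters are
absorbed by changing the sign of the exponent. -/
theorem exists_word (ha : ∀ i, a i ∈ firstLayer G) {F : X → G} (hF : F ∈ wordMaps X a) :
    ∃ (L : ℕ) (w : Fin L → ι) (α : X → Fin L → ℝ), Differentiable ℝ α ∧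
      ∀ x, F x = wordMap a w (α x) := by
  have hletter : ∀ (i : ι) (α : X → ℝ), Differentiable ℝ α → ∃ (L : ℕ) (w : Fin L → ι)
      (β : X → Fin L → ℝ), Differentiable ℝ β ∧ ∀ x, dil (α x) (a i) = wordMap a w (β x) :=
    fun i α hα => ⟨1, fun _ => i, fun x _ => α x, differentiable_pi.2 fun _ => hα,
      fun x => by simp [wordMap]⟩
  induction hF using Subgroup.closure_induction'' with
  | mem F hF =>
    obtain ⟨i, α, hα, rfl⟩ := hF
    exact hletter i α hα
  | inv_mem F hF =>
    obtain ⟨i, α, hα, rfl⟩ := hF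
    obtain ⟨L, w, β, hβ, h⟩ := hletter i (fun x => -α x) hα.neg
    refine ⟨L, w, β, hβ, fun x => ?_⟩
    rw [← h, dil_neg_of_mem_firstLayer (ha i), Pi.inv_apply]
  | one => exact ⟨0, Fin.elim0, fun _ => 0, differentiable_const _, fun x => by simp [wordMap]⟩
  | mul F F' _ _ h h' =>
    obtain ⟨L, w, β, hβ, h⟩ := h
    obtain ⟨L', w', β', hβ', h'⟩ := h'
    refine ⟨L + L', Fin.append w w', fun x => Fin.append (β x) (β' x), ?_, fun x => ?_⟩
    · rw [differentiable_pi]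
      intro j
      refine Fin.addCases (fun j => ?_) (fun j => ?_) j
      · simpa using differentiable_pi.1 hβ j
      · simpa using differentiable_pi.1 hβ' j
    · rw [wordMap_append, ← h, ← h', Pi.mul_apply]

end Words

/-! ### Homogeneous charts -/

section Charts

variable {G Q : Type*} [Group G] [TopologicalSpace G] [IsTopologicalGroup G] [ScalableGroup G]
  [Group Q] [TopologicalSpace Q] [IsTopologicalGroup Q] [ScalableGroup Q]

/-- Coordinates of the second kind on a scalable group of nilpotency class at most `s`: one-parameter
subgroups `e_j` in `Γ (d_j)`, homogeneous of degree `d_j`, such that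
`(x_0, …, x_{n-1}) ↦ e_0(x_0) ⋯ e_{n-1}(x_{n-1})` is a homeomorphism of `ℝ^n` onto `G`. Those of the
top degree `s` generate the last term of the lower central series. -/
structure HomogeneousChart (G : Type*) [Group G] [TopologicalSpace G] [IsTopologicalGroup G]
    [ScalableGroup G] (s : ℕ) where
  /-- The dimension. -/
  n : ℕ
  /-- The degree of each coordinate. -/
  deg : Fin n → ℕ
  /-- The one-parameter subgroups `e_j`. -/
  curve : Fin n → ℝ → G
  deg_ne_zero : ∀ j, deg j ≠ 0
  deg_le : ∀ j, deg j ≤ s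
  continuous_curve : ∀ j, Continuous (curve j)
  curve_add : ∀ j t u, curve j (t + u) = curve j t * curve j u
  dil_curve : ∀ j (l t : ℝ), dil l (curve j t) = curve j (l ^ deg j * t)
  curve_mem : ∀ j t, curve j t ∈ lcsFiltration G (deg j)
  lcsFiltration_le : lcsFiltration G s ≤ Subgroup.closure {x | ∃ j, ∃ t, deg j = s ∧ x = curve j t}
  /-- The coordinates as a homeomorphism onto `ℝ^n`. -/
  toHomeo : G ≃ₜ (Fin n → ℝ)
  symm_apply : ∀ x, toHomeo.symm x = (List.ofFn fun j => curve j (x j)).prod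

namespace HomogeneousChart

/-- The coordinates of a continuous polynomial map are polynomials of degree at most the degree of
the coordinate. -/
def IsPolynomial {s : ℕ} (C : HomogeneousChart G s) : Prop :=
  ∀ (L : ℕ) (f : (Fin L → ℝ) → G), Continuous f → (∀ k, IsPolyMap k 0 f) →
    ∀ j, IsPolyDeg (C.deg j + 1) fun v => C.toHomeo (f v) j

variable {s : ℕ} {C : HomogeneousChart G s}

/-- The inverse of the chart, evaluated at polynomials of the degrees of the coordinates, is a
polynomial map. -/
theorem isPolyMap_symm_comp {V : Type*} [AddCommGroup V] (C : HomogeneousChart G s)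
    {q : V → Fin C.n → ℝ} (hq : ∀ j, IsPolyDeg (C.deg j + 1) fun v => q v j) (k : ℕ) :
    IsPolyMap k 0 fun v => C.toHomeo.symm (q v) := by
  simp only [C.symm_apply]
  exact IsPolyMap.list_prod fun j =>
    IsPolyMap.curve_comp (C.curve_add j) (C.curve_mem j) k (hq j)

theorem IsPolynomial.exists_mvPolynomial (hC : C.IsPolynomial) {L : ℕ} {f : (Fin L → ℝ) → G}
    (hf : Continuous f) (hpoly : ∀ k, IsPolyMap k 0 f) :
    ∃ P : Fin C.n → MvPolynomial (Fin L) ℝ,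
      ∀ x j, C.toHomeo (f x) j = MvPolynomial.eval x (P j) := by
  have h := fun j => (hC L f hf hpoly j).exists_mvPolynomial
    ((continuous_apply j).comp (C.toHomeo.continuous.comp hf))
  choose P hP using h
  exact ⟨P, fun x j => hP j x⟩

theorem IsPolynomial.differentiable (hC : C.IsPolynomial) {L : ℕ} {f : (Fin L → ℝ) → G}
    (hf : Continuous f) (hpoly : ∀ k, IsPolyMap k 0 f) :
    Differentiable ℝ fun x => C.toHomeo (f x) := by
  obtain ⟨P, hP⟩ := hC.exists_mvPolynomial hf hpoly
  rw [differentiable_pi]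
  intro j
  simp only [hP]
  exact fun x => ((P j).hasStrictFDerivAt_eval x).hasFDerivAt.differentiableAt

theorem IsPolynomial.differentiable_of_mem_wordMaps (hC : C.IsPolynomial) {ι : Type*} {a : ι → G}
    (ha : ∀ i, a i ∈ firstLayer G) {X : Type*} [NormedAddCommGroup X] [NormedSpace ℝ X]
    {F : X → G} (hF : F ∈ wordMaps X a) : Differentiable ℝ fun x => C.toHomeo (F x) := by
  obtain ⟨L, w, α, hα, h⟩ := exists_word ha hF
  simp only [h]
  exact (hC.differentiable (continuous_wordMap a w) (isPolyMap_wordMap ha w)).comp hα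

end HomogeneousChart

/-- The chart of a trivial group. -/
def HomogeneousChart.trivial [Subsingleton G] : HomogeneousChart G 0 where
  n := 0
  deg := Fin.elim0
  curve := Fin.elim0
  deg_ne_zero j := j.elim0
  deg_le j := j.elim0
  continuous_curve j := j.elim0
  curve_add j := j.elim0
  dil_curve j := j.elim0
  curve_mem j := j.elim0
  lcsFiltration_le := fun x _ => by rw [Subsingleton.elim x 1]; exact one_mem _
  toHomeo :=
    { toFun := fun _ => 0
      invFun := fun _ => 1
      left_inv := fun _ => Subsingleton.elim _ _
      right_inv := fun _ => Subsingleton.elim _ _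
      continuous_toFun := continuous_const
      continuous_invFun := continuous_const }
  symm_apply x := Subsingleton.elim _ _

theorem continuous_append {X : Type*} [TopologicalSpace X] {n k : ℕ} {f : X → Fin n → ℝ}
    {g : X → Fin k → ℝ} (hf : Continuous f) (hg : Continuous g) :
    Continuous fun x => Fin.append (f x) (g x) := by
  refine continuous_pi fun j => ?_
  refine Fin.addCases (fun j => ?_) (fun j => ?_) j
  · simpa [Function.comp_def] using (continuous_apply j).comp hf
  · simpa [Function.comp_def] using (continuous_apply j).comp hg

namespace CentralLayer

variable {s k : ℕ} (Z : CentralLayer G Q s k)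

theorem prod_incl_single (u : Fin k → ℝ) :
    (List.ofFn fun l => Z.incl (Pi.single l (u l))).prod = Z.incl u := by
  have h : (List.ofFn fun l => Z.incl (Pi.single l (u l))) =
      (List.ofFn fun l => Multiplicative.ofAdd (Pi.single l (u l) : Fin k → ℝ)).map Z.inclHom := by
    rw [List.map_ofFn]; rfl
  rw [h, ← map_list_prod, List.prod_ofFn, ← ofAdd_sum, Finset.univ_sum_single]
  rfl

theorem exists_coord : ∃ z : {g : G // Z.proj g = 1} → Fin k → ℝ, Continuous z ∧
    ∀ g, Z.incl (z g) = g := by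
  let h := Z.isClosedEmbedding.isEmbedding.toHomeomorph
  refine ⟨fun g => h.symm ⟨g.1, (Z.proj_eq_one_iff _).1 g.2⟩,
    h.symm.continuous.comp (by fun_prop), fun g => ?_⟩
  exact congrArg Subtype.val (h.apply_symm_apply ⟨g.1, (Z.proj_eq_one_iff _).1 g.2⟩)

/-- A chart of the quotient by a central layer extends to a chart of the group: lift its curves and
append the coordinates of the layer. -/
theorem exists_chart [T2Space G] (Z : CentralLayer G Q s k) (C : HomogeneousChart Q s)
    (htop : ∀ g ∈ (⊤ : Subgroup G).lowerCentralSeries s, g ∈ Set.range Z.incl) :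
    ∃ (D : HomogeneousChart G (s + 1)) (hn : D.n = C.n + k),
      (∀ j, D.deg (Fin.cast hn.symm (Fin.castAdd k j)) = C.deg j) ∧
      (∀ l, D.deg (Fin.cast hn.symm (Fin.natAdd C.n l)) = s + 1) ∧
      (∀ g j, D.toHomeo g (Fin.cast hn.symm (Fin.castAdd k j)) = C.toHomeo (Z.proj g) j) ∧
      ∀ x : Fin C.n → ℝ, ∀ z : Fin k → ℝ,
        D.toHomeo.symm (Fin.append x z ∘ Fin.cast hn) =
          D.toHomeo.symm (Fin.append x 0 ∘ Fin.cast hn) * Z.incl z := by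
  have hlift := fun j => Z.exists_curve_lift (C.deg_ne_zero j) (C.deg_le j)
    (C.continuous_curve j) (C.curve_add j) (C.dil_curve j)
  choose e hec headd hedil heproj using hlift
  let base : (Fin C.n → ℝ) → G := fun x => (List.ofFn fun j => e j (x j)).prod
  have hbase : Continuous base :=
    continuous_list_prod_ofFn fun j => (hec j).comp (continuous_apply j)
  have hproj : ∀ x, Z.proj (base x) = C.toHomeo.symm x := fun x => by
    rw [C.symm_apply, map_list_prod, List.map_ofFn]
    simp only [Function.comp_def, heproj]
  obtain ⟨z, hz, hzi⟩ := Z.exists_coord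
  let r : G → {g : G // Z.proj g = 1} := fun g =>
    ⟨(base (C.toHomeo (Z.proj g)))⁻¹ * g, by
      rw [map_mul, map_inv, hproj, C.toHomeo.symm_apply_apply, inv_mul_cancel]⟩
  have hprojc : Continuous Z.proj := Z.isOpenQuotientMap.continuous
  have hr : Continuous r := Continuous.subtype_mk
    (((hbase.comp (C.toHomeo.continuous.comp hprojc)).inv).mul continuous_id) _
  let Ψ : G ≃ₜ (Fin (C.n + k) → ℝ) :=
    { toFun := fun g => Fin.append (C.toHomeo (Z.proj g)) (z (r g))
      invFun := fun x => base (fun j => x (Fin.castAdd k j)) *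
        Z.incl fun l => x (Fin.natAdd C.n l)
      left_inv := fun g => by simp [hzi, r]
      right_inv := fun x => by
        have h1 : C.toHomeo (Z.proj (base (fun j => x (Fin.castAdd k j)) *
            Z.incl fun l => x (Fin.natAdd C.n l))) = fun j => x (Fin.castAdd k j) := by
          rw [map_mul, Z.proj_incl, mul_one, hproj, C.toHomeo.apply_symm_apply]
        ext j
        refine Fin.addCases (fun j => ?_) (fun l => ?_) j
        · simp only [Fin.append_left, h1]
        · have h2 : z (r (base (fun j => x (Fin.castAdd k j)) *
              Z.incl fun l => x (Fin.natAdd C.n l))) = fun l => x (Fin.natAdd C.n l) := by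
            apply Z.isClosedEmbedding.injective
            rw [hzi]
            simp only [r, h1, inv_mul_cancel_left]
          simp [h2]
      continuous_toFun :=
        continuous_append (C.toHomeo.continuous.comp hprojc) (hz.comp hr)
      continuous_invFun := (hbase.comp (by fun_prop)).mul
        (Z.isClosedEmbedding.continuous.comp (by fun_prop)) }
  let D : HomogeneousChart G (s + 1) :=
    { n := C.n + k
      deg := Fin.append C.deg fun _ => s + 1
      curve := Fin.append e fun l t => Z.incl (Pi.single l t)
      deg_ne_zero := fun j => by
        refine Fin.addCases (fun j => ?_) (fun l => ?_) j
        · simpa using C.deg_ne_zero j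
        · simp
      deg_le := fun j => by
        refine Fin.addCases (fun j => ?_) (fun l => ?_) j
        · simpa using (C.deg_le j).trans (Nat.le_succ s)
        · simp
      continuous_curve := fun j => by
        refine Fin.addCases (fun j => ?_) (fun l => ?_) j
        · simpa using hec j
        · simpa [Function.comp_def] using
            Z.isClosedEmbedding.continuous.comp (continuous_single l)
      curve_add := fun j t u => by
        refine Fin.addCases (fun j => ?_) (fun l => ?_) j
        · simpa using headd j t u
        · simp only [Fin.append_right]
          rw [← Z.incl_add, ← Pi.single_add]
      dil_curve := fun j l t => by
        refine Fin.addCases (fun j => ?_) (fun i => ?_) j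
        · simpa using hedil j l t
        · simp only [Fin.append_right, Z.dil_incl]
          rw [← Pi.single_smul, smul_eq_mul]
      curve_mem := fun j t => by
        refine Fin.addCases (fun j => ?_) (fun l => ?_) j
        · simp only [Fin.append_left]
          -- `e_j(t)` agrees with a point of `Γ (d_j)` up to the central layer, which lies in it.
          have h1 : Z.proj (e j t) ∈ lcsFiltration Q (C.deg j) := heproj j t ▸ C.curve_mem j t
          rw [lcsFiltration, ← MonoidHom.range_eq_top.2 Z.isOpenQuotientMap.surjective,
            MonoidHom.range_eq_map, ← Subgroup.map_lowerCentralSeries] at h1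
          obtain ⟨y, hy, hyx⟩ := h1
          obtain ⟨u, hu⟩ := Z.exists_mul_incl hyx
          rw [hu]
          refine mul_mem hy (Subgroup.lowerCentralSeries_antitone _ ?_ (Z.incl_mem u))
          have := C.deg_le j
          omega
        · simpa [lcsFiltration] using Z.incl_mem (Pi.single l t)
      lcsFiltration_le := fun x hx => by
        obtain ⟨u, rfl⟩ := htop x hx
        rw [← Z.prod_incl_single]
        refine Subgroup.list_prod_mem _ fun y hy => ?_
        obtain ⟨l, rfl⟩ := (List.mem_ofFn' _ _).1 hy
        exact Subgroup.subset_closure ⟨Fin.natAdd C.n l, u l, by simp, by simp⟩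
      toHomeo := Ψ
      symm_apply := fun x => by
        have h1 : (fun j => Fin.append e (fun l t => Z.incl (Pi.single l t)) j (x j)) =
            Fin.append (fun j => e j (x (Fin.castAdd k j)))
              fun l => Z.incl (Pi.single l (x (Fin.natAdd C.n l))) := by
          ext j
          refine Fin.addCases (fun j => ?_) (fun l => ?_) j <;> simp
        rw [h1, List.ofFn_fin_append, List.prod_append,
          Z.prod_incl_single (fun l => x (Fin.natAdd C.n l))]
        rfl }
  refine ⟨D, rfl, fun j => ?_, fun l => ?_, fun g j => ?_, fun x z => ?_⟩
  · simp [D]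
  · simp [D]
  · simp [D, Ψ]
  · have h : ∀ y : Fin (C.n + k) → ℝ, D.toHomeo.symm y =
        base (fun j => y (Fin.castAdd k j)) * Z.incl fun l => y (Fin.natAdd C.n l) := fun y => rfl
    rw [h, h]
    simp only [Function.comp_apply, Fin.cast_eq_self, Fin.append_left, Fin.append_right]
    have h0 : (fun l : Fin k => (0 : Fin k → ℝ) l) = 0 := rfl
    rw [h0, Z.incl_zero, mul_one]

end CentralLayer

end Charts

end ScalableGroup

/-! ### Extending a chart through a central layer -/

theorem list_prod_ofFn_mul_of_central {G : Type*} [Group G] {n : ℕ} {f g : Fin n → G}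
    (hf : ∀ j, f j ∈ Subgroup.center G) :
    (List.ofFn fun j => f j * g j).prod = (List.ofFn f).prod * (List.ofFn g).prod := by
  induction n with
  | zero => simp
  | succ n ih =>
    simp only [List.ofFn_succ, List.prod_cons]
    rw [ih fun j => hf j.succ]
    have hc : (List.ofFn fun j : Fin n => f j.succ).prod ∈ Subgroup.center G :=
      Subgroup.list_prod_mem _ fun y hy => by
        obtain ⟨j, rfl⟩ := (List.mem_ofFn' _ _).1 hy
        exact hf _
    have h1 := Subgroup.mem_center_iff.1 hc (g 0)
    simp only [mul_assoc]
    rw [← mul_assoc (g 0), h1, mul_assoc]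

namespace ScalableGroup

open Topology Filter

section Extension

variable {G Q : Type*} [Group G] [TopologicalSpace G] [IsTopologicalGroup G] [ScalableGroup G]
  [Group Q] [TopologicalSpace Q] [IsTopologicalGroup Q] [ScalableGroup Q] {ι : Type*} {a : ι → G}

namespace CentralLayer

variable {s k : ℕ}

/-- Polynomial maps into a central layer have polynomial coordinates: their differences of order
`m` vanish once they land beyond the end of the lower central series. -/
theorem isPolyDeg_of_isPolyMap (Z : CentralLayer G Q s k)
    (hnil : (⊤ : Subgroup G).lowerCentralSeries (s + 1) = ⊥) {V : Type*} [AddCommGroup V]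
    {m i : ℕ} (hmi : m + i = s + 2) {z : V → Fin k → ℝ}
    (hz : IsPolyMap m i fun v => Z.incl (z v)) (l : Fin k) : IsPolyDeg m fun v => z v l := by
  induction m generalizing i z with
  | zero =>
    intro v
    have h := hz v
    rw [lcsFiltration, show i - 1 = s + 1 by omega, hnil, Subgroup.mem_bot, ← Z.incl_zero] at h
    exact congrFun (Z.isClosedEmbedding.injective h) l
  | succ m ih =>
    intro h
    refine ih (i := i + 1) (z := fun v => z (v + h) - z v) (by omega) ?_
    convert hz.2 h using 2 with v
    rw [← Z.incl_neg, ← Z.incl_add, neg_add_eq_sub]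

/-- The inductive step: a chart of the quotient by a central layer, with its polynomial and word
structure, yields one of the group. -/
theorem exists_chart_isPolynomial [T2Space G] (Z : CentralLayer G Q s k)
    (hnil : (⊤ : Subgroup G).lowerCentralSeries (s + 1) = ⊥)
    (ha : ∀ i, a i ∈ firstLayer G) (C : HomogeneousChart Q s) (hC : C.IsPolynomial)
    (hCw : ⇑C.toHomeo.symm ∈ wordMaps (Fin C.n → ℝ) (Z.proj ∘ a))
    (hZw : Z.incl ∈ wordMaps (Fin k → ℝ) a)
    (htop : ∀ g ∈ (⊤ : Subgroup G).lowerCentralSeries s, g ∈ Set.range Z.incl) :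
    ∃ D : HomogeneousChart G (s + 1), D.IsPolynomial ∧
      ⇑D.toHomeo.symm ∈ wordMaps (Fin D.n → ℝ) a := by
  obtain ⟨D, hn, hdeg, hdeg', hbase, hsymm⟩ := Z.exists_chart C htop
  let zc : G → Fin k → ℝ := fun g l => D.toHomeo g (Fin.cast hn.symm (Fin.natAdd C.n l))
  have hD : ∀ g, D.toHomeo g = Fin.append (C.toHomeo (Z.proj g)) (zc g) ∘ Fin.cast hn := by
    intro g
    ext j
    obtain ⟨j, rfl⟩ : ∃ j', j = Fin.cast hn.symm j' := ⟨Fin.cast hn j, by simp⟩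
    refine Fin.addCases (fun j => ?_) (fun l => ?_) j
    · simpa using hbase g j
    · simp [zc]
  have hsplit : ∀ g, g = D.toHomeo.symm (Fin.append (C.toHomeo (Z.proj g)) 0 ∘ Fin.cast hn) *
      Z.incl (zc g) := fun g => by
    rw [← hsymm, ← hD, D.toHomeo.symm_apply_apply]
  have hDpoly : D.IsPolynomial := by
    intro L f hf hpoly
    have hq : ∀ j, IsPolyDeg (C.deg j + 1) fun v => C.toHomeo (Z.proj (f v)) j :=
      hC L _ (Z.isOpenQuotientMap.continuous.comp hf) fun k => (hpoly k).map Z.proj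
    have hg : ∀ m, IsPolyMap m 0 fun v =>
        D.toHomeo.symm (Fin.append (C.toHomeo (Z.proj (f v))) 0 ∘ Fin.cast hn) := by
      refine D.isPolyMap_symm_comp fun j => ?_
      obtain ⟨j, rfl⟩ : ∃ j', j = Fin.cast hn.symm j' := ⟨Fin.cast hn j, by simp⟩
      refine Fin.addCases (fun j => ?_) (fun l => ?_) j
      · simpa [hdeg] using hq j
      · simpa [hdeg'] using IsPolyDeg.zero (s + 1 + 1)
    have hz : ∀ m, IsPolyMap m 0 fun v => Z.incl (zc (f v)) := by
      intro m
      convert (hg m).inv.mul (hpoly m) using 2 with v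
      rw [eq_inv_mul_iff_mul_eq, ← hsplit]
    intro j
    obtain ⟨j, rfl⟩ : ∃ j', j = Fin.cast hn.symm j' := ⟨Fin.cast hn j, by simp⟩
    refine Fin.addCases (fun j => ?_) (fun l => ?_) j
    · simpa [hdeg, hbase] using hq j
    · rw [hdeg']
      exact Z.isPolyDeg_of_isPolyMap hnil (by omega) (hz (s + 2)) l
  refine ⟨D, hDpoly, ?_⟩
  -- Lift the word map of the quotient to `Θ`, and correct its component in the layer by a word map.
  obtain ⟨Θ, hΘ, hΘp⟩ := exists_lift_mem_wordMaps Z.proj_dil hCw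
  have hζ : Differentiable ℝ fun x => zc (Θ x) := by
    have := hDpoly.differentiable_of_mem_wordMaps ha hΘ
    exact differentiable_pi.2 fun l => differentiable_pi.1 this _
  let ρ : (Fin D.n → ℝ) → Fin C.n → ℝ := fun y j => y (Fin.cast hn.symm (Fin.castAdd k j))
  have hρ : Differentiable ℝ ρ := by fun_prop
  let τ : (Fin D.n → ℝ) → Fin k → ℝ := fun y => (fun l =>
    y (Fin.cast hn.symm (Fin.natAdd C.n l))) - zc (Θ (ρ y))
  have hτ : Differentiable ℝ τ := Differentiable.sub (by fun_prop) (hζ.comp hρ)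
  have hfinal : ⇑D.toHomeo.symm = (Θ ∘ ρ) * (Z.incl ∘ τ) := by
    ext y
    have hy : y = Fin.append (ρ y) (fun l => y (Fin.cast hn.symm (Fin.natAdd C.n l))) ∘
        Fin.cast hn := by
      ext j
      obtain ⟨j, rfl⟩ : ∃ j', j = Fin.cast hn.symm j' := ⟨Fin.cast hn j, by simp⟩
      refine Fin.addCases (fun j => ?_) (fun l => ?_) j <;> simp [ρ]
    have h1 := hsplit (Θ (ρ y))
    rw [hΘp, C.toHomeo.apply_symm_apply] at h1
    conv_lhs => rw [hy, hsymm]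
    rw [Pi.mul_apply, Function.comp_apply, h1, mul_assoc, Function.comp_apply, ← Z.incl_add]
    congr 2
    simp [τ]
  rw [hfinal]
  exact mul_mem (comp_mem_wordMaps hΘ hρ) (comp_mem_wordMaps hZw hτ)

end CentralLayer

/-! ### The last term of the lower central series -/

theorem list_prod_mem_wordMaps {X : Type*} [NormedAddCommGroup X] [NormedSpace ℝ X] {n : ℕ}
    {F : Fin n → X → G} (hF : ∀ j, F j ∈ wordMaps X a) :
    (fun x => (List.ofFn fun j => F j x).prod) ∈ wordMaps X a := by
  induction n with
  | zero =>
    simp only [List.ofFn_zero, List.prod_nil]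
    exact one_mem (wordMaps X a)
  | succ n ih =>
    simp only [List.ofFn_succ, List.prod_cons]
    exact mul_mem (hF 0) (ih fun j => hF j.succ)

/-- If the last nontrivial term `lcs s` is generated by finitely many one-parameter subgroups that
are homogeneous of degree `s + 1`, it is a central layer. In particular it is closed. -/
theorem exists_centralLayer [T2Space G] {s N : ℕ}
    (hnil : (⊤ : Subgroup G).lowerCentralSeries (s + 1) = ⊥) {π : G →* Q}
    (hπ : IsOpenQuotientMap π) (hπd : ∀ t g, π (dil t g) = dil t (π g))
    (hker : ∀ g, π g = 1 ↔ g ∈ ((⊤ : Subgroup G).lowerCentralSeries s).topologicalClosure)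
    {c : Fin N → ℝ → G} (hc : ∀ w, Continuous (c w)) (hadd : ∀ w t u, c w (t + u) = c w t * c w u)
    (hdil : ∀ w (l t : ℝ), dil l (c w t) = c w (l ^ (s + 1) * t))
    (hword : ∀ w, c w ∈ wordMaps ℝ a)
    (hlcs : (⊤ : Subgroup G).lowerCentralSeries s = Subgroup.closure {x | ∃ w t, x = c w t}) :
    ∃ (k : ℕ) (Z : CentralLayer G Q s k), Z.proj = π ∧ Z.incl ∈ wordMaps (Fin k → ℝ) a ∧
      ∀ g ∈ (⊤ : Subgroup G).lowerCentralSeries s, g ∈ Set.range Z.incl := by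
  have hcen : (⊤ : Subgroup G).lowerCentralSeries s ≤ Subgroup.center G :=
    Subgroup.commutator_top_right_eq_bot_iff_le_center.1 hnil
  have hcmem : ∀ w t, c w t ∈ (⊤ : Subgroup G).lowerCentralSeries s := fun w t =>
    hlcs ▸ Subgroup.subset_closure ⟨w, t, rfl⟩
  have hc0 : ∀ w, c w 0 = 1 := fun w => by simpa using hadd w 0 0
  let φ : (Fin N → ℝ) → G := fun u => (List.ofFn fun w => c w (u w)).prod
  have hφ : Continuous φ := continuous_list_prod_ofFn fun w => (hc w).comp (continuous_apply w)
  have hφadd : ∀ u v, φ (u + v) = φ u * φ v := fun u v => by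
    simp only [φ, Pi.add_apply, hadd]
    exact list_prod_ofFn_mul_of_central fun w => hcen (hcmem w _)
  have hφ0 : φ 0 = 1 := by simpa using hφadd 0 0
  have hφneg : ∀ u, φ (-u) = (φ u)⁻¹ := fun u => by
    rw [eq_inv_iff_mul_eq_one, ← hφadd, neg_add_cancel, hφ0]
  have hφdil : ∀ (t : ℝ) u, dil t (φ u) = φ (t ^ (s + 1) • u) := fun t u => by
    rw [← dilHom_apply, map_list_prod, List.map_ofFn]
    simp only [φ, Function.comp_def, dilHom_apply, hdil, Pi.smul_apply, smul_eq_mul]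
  have hφmem : ∀ u, φ u ∈ (⊤ : Subgroup G).lowerCentralSeries s := fun u =>
    Subgroup.list_prod_mem _ fun y hy => by
      obtain ⟨j, rfl⟩ := (List.mem_ofFn' _ _).1 hy
      exact hcmem _ _
  have hφsingle : ∀ w t, φ (Pi.single w t) = c w t := fun w t => by
    have h : ∀ (n : ℕ) (w : Fin n) (c : Fin n → ℝ → G), (∀ w, c w 0 = 1) →
        (List.ofFn fun w' => c w' ((Pi.single w t : Fin n → ℝ) w')).prod = c w t := by
      intro n
      induction n with
      | zero => exact fun w => w.elim0
      | succ n ih =>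
        intro w c hc0
        rw [List.ofFn_succ, List.prod_cons]
        refine Fin.cases ?_ (fun w => ?_) w
        · simp [hc0]
        · have h2 : ∀ i : Fin n, (Pi.single w.succ t : Fin (n + 1) → ℝ) i.succ =
              (Pi.single w t : Fin n → ℝ) i := fun i => by
            simp [Pi.single_apply]
          simp only [h2]
          rw [ih w (fun i => c i.succ) fun i => hc0 _]
          simp [hc0]
    exact h N w c hc0
  have hφsurj : ∀ g ∈ (⊤ : Subgroup G).lowerCentralSeries s, ∃ u, φ u = g := by
    intro g hg
    rw [hlcs] at hg
    induction hg using Subgroup.closure_induction with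
    | mem x hx =>
      obtain ⟨w, t, rfl⟩ := hx
      exact ⟨_, hφsingle w t⟩
    | one => exact ⟨0, hφ0⟩
    | mul x y _ _ hx hy =>
      obtain ⟨u, rfl⟩ := hx
      obtain ⟨v, rfl⟩ := hy
      exact ⟨u + v, hφadd u v⟩
    | inv x _ hx =>
      obtain ⟨u, rfl⟩ := hx
      exact ⟨-u, hφneg u⟩
  -- The kernel of `φ` is a linear subspace, by homogeneity.
  let K : Submodule ℝ (Fin N → ℝ) :=
    { carrier := {u | φ u = 1}
      add_mem' := fun {u v} hu hv => by
        rw [Set.mem_ofPred_eq] at *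
        rw [hφadd, hu, hv, one_mul]
      zero_mem' := hφ0
      smul_mem' := fun r u hu => by
        rw [Set.mem_ofPred_eq] at *
        have hpos : ∀ r : ℝ, 0 ≤ r → φ (r • u) = 1 := fun r hr => by
          have h1 := hφdil (r ^ (((s + 1 : ℕ) : ℝ)⁻¹)) u
          rw [Real.rpow_inv_natCast_pow hr (Nat.succ_ne_zero s), hu, dil_map_one] at h1
          exact h1.symm
        rcases le_total 0 r with hr | hr
        · exact hpos r hr
        · rw [← neg_neg (r • u), hφneg, ← neg_smul, hpos (-r) (by linarith), inv_one] }
  let κ : (Fin N → ℝ) →ₗ[ℝ] Fin (Module.finrank ℝ ((Fin N → ℝ) ⧸ K)) → ℝ :=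
    (Module.finBasis ℝ ((Fin N → ℝ) ⧸ K)).equivFun.toLinearMap ∘ₗ K.mkQ
  have hκ : Function.Surjective κ :=
    (Module.finBasis ℝ ((Fin N → ℝ) ⧸ K)).equivFun.surjective.comp (Submodule.mkQ_surjective K)
  have hκker : ∀ u, κ u = 0 ↔ φ u = 1 := fun u => by
    have : κ u = 0 ↔ u ∈ K := by simp [κ]
    exact this
  obtain ⟨σ, hσ⟩ := κ.exists_rightInverse_of_surjective (LinearMap.range_eq_top.2 hκ)
  have hσ' : ∀ v, κ (σ v) = v := fun v => LinearMap.congr_fun hσ v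
  have hσκ : ∀ u, φ (σ (κ u)) = φ u := fun u => by
    have h1 : φ (σ (κ u) - u) = 1 := (hκker _).1 (by rw [map_sub, hσ', sub_self])
    rwa [sub_eq_add_neg, hφadd, hφneg, mul_inv_eq_one] at h1
  have hσc : Continuous σ := LinearMap.continuous_of_finiteDimensional σ
  have hinj : Function.Injective (φ ∘ σ) := by
    intro u v huv
    have h1 : φ (σ (u - v)) = 1 := by
      rw [map_sub, sub_eq_add_neg, hφadd, hφneg, mul_inv_eq_one]
      exact huv
    have h2 := (hκker _).2 h1
    rwa [hσ', sub_eq_zero] at h2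
  have hdil' : ∀ (t : ℝ) u, dil t ((φ ∘ σ) u) = (φ ∘ σ) (t ^ (s + 1) • u) := fun t u => by
    simp only [Function.comp_apply, hφdil, map_smul]
  have hemb : IsClosedEmbedding (φ ∘ σ) := isClosedEmbedding_of_homogeneous (Nat.succ_ne_zero s)
    (hφ.comp hσc) hinj (by simp [hφ0]) hdil'
  have hrange : Set.range (φ ∘ σ) = ((⊤ : Subgroup G).lowerCentralSeries s : Set G) := by
    ext g
    constructor
    · rintro ⟨u, rfl⟩
      exact hφmem _
    · intro hg
      obtain ⟨u, rfl⟩ := hφsurj g hg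
      exact ⟨κ u, hσκ u⟩
  have hclosed : ((⊤ : Subgroup G).lowerCentralSeries s).topologicalClosure =
      (⊤ : Subgroup G).lowerCentralSeries s := by
    apply SetLike.coe_injective
    rw [Subgroup.topologicalClosure_coe, ← hrange]
    exact hemb.isClosed_range.closure_eq
  refine ⟨_, ⟨π, hπ, hπd, φ ∘ σ, fun u v => ?_, hemb, hdil', fun u g => ?_, fun g => ?_,
    fun u => hφmem _⟩, rfl, ?_, fun g hg => ?_⟩
  · simp only [Function.comp_apply, map_add, hφadd]
  · exact (Subgroup.mem_center_iff.1 (hcen (hφmem _)) g).symm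
  · rw [hker, hclosed, hrange]; rfl
  · have hφw : φ ∈ wordMaps (Fin N → ℝ) a := list_prod_mem_wordMaps fun w =>
      comp_mem_wordMaps (hword w) (g := fun u : Fin N → ℝ => u w) (by fun_prop)
    exact comp_mem_wordMaps hφw (LinearMap.toContinuousLinearMap σ).differentiable
  · change g ∈ Set.range (φ ∘ σ)
    rw [hrange]
    exact hg

end Extension

end ScalableGroup

namespace ScalableGroup

open Topology Filter

/-! ### Commutators with the top curves of the quotient -/

section Commutators

theorem commutatorElement_mul_left_of_central {G : Type*} [Group G] {x x' y : G}
    (h : ⁅x', y⁆ ∈ Subgroup.center G) : ⁅x * x', y⁆ = ⁅x, y⁆ * ⁅x', y⁆ := by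
  have h1 := Subgroup.mem_center_iff.1 h x
  have h2 : ⁅x * x', y⁆ = x * ⁅x', y⁆ * x⁻¹ * ⁅x, y⁆ := by
    simp only [commutatorElement_def]; group
  rw [h2, h1, mul_inv_cancel_right, Subgroup.mem_center_iff.1 h]

theorem commutatorElement_mul_right_of_central {G : Type*} [Group G] {x y y' : G}
    (h : ⁅x, y'⁆ ∈ Subgroup.center G) : ⁅x, y * y'⁆ = ⁅x, y⁆ * ⁅x, y'⁆ := by
  have h1 := Subgroup.mem_center_iff.1 h y
  have h2 : ⁅x, y * y'⁆ = ⁅x, y⁆ * (y * ⁅x, y'⁆ * y⁻¹) := by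
    simp only [commutatorElement_def]; group
  rw [h2, h1, mul_inv_cancel_right]

/-- A biadditive map `b` from `ℝ × ℝ` to a group is real bilinear, in the form `b t u = b 1 (t u)`,
under the weak continuity assumptions that `b 1` is continuous and that each `b · u` is continuous
on `[0, ∞)`: the identity passes from rational `t` to all `t`. -/
theorem biadditive_eq {G : Type*} [Group G] [TopologicalSpace G] [T2Space G] {b : ℝ → ℝ → G}
    (hleft : ∀ t t' u, b (t + t') u = b t u * b t' u)
    (hright : ∀ t u u', b t (u + u') = b t u * b t u') (hc : Continuous (b 1))
    (hpos : ∀ u, ∃ F : ℝ → G, Continuous F ∧ ∀ t, 0 ≤ t → F t = b t u) (t u : ℝ) :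
    b t u = b 1 (t * u) := by
  have hl0 : ∀ u, b 0 u = 1 := fun u => by simpa using hleft 0 0 u
  have hr0 : ∀ t, b t 0 = 1 := fun t => by simpa using hright t 0 0
  have hln : ∀ (n : ℕ) t u, b (n * t) u = b t u ^ n := fun n t u => by
    induction n with
    | zero => simp [hl0]
    | succ n ih => rw [Nat.cast_succ, add_mul, one_mul, hleft, ih, pow_succ]
  have hrn : ∀ (n : ℕ) t u, b t (n * u) = b t u ^ n := fun n t u => by
    induction n with
    | zero => simp [hr0]
    | succ n ih => rw [Nat.cast_succ, add_mul, one_mul, hright, ih, pow_succ]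
  have hlneg : ∀ t u, b (-t) u = (b t u)⁻¹ := fun t u => by
    rw [eq_inv_iff_mul_eq_one, ← hleft, neg_add_cancel, hl0]
  have hrneg : ∀ t u, b t (-u) = (b t u)⁻¹ := fun t u => by
    rw [eq_inv_iff_mul_eq_one, ← hright, neg_add_cancel, hr0]
  have hnnrat : ∀ m n : ℕ, n ≠ 0 → ∀ u, b (m / n) u = b 1 (m / n * u) := fun m n hn u => by
    have hn' : (n : ℝ) ≠ 0 := Nat.cast_ne_zero.2 hn
    have h1 : b (m / n) u = b (n * (m / n)) (u / n) := by
      rw [hln, ← hrn]; congr 1; field_simp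
    rw [h1, show (n : ℝ) * (m / n) = m * 1 by field_simp, hln, ← hrn]
    congr 1; field_simp
  have hnonneg : ∀ t, 0 ≤ t → ∀ u, b t u = b 1 (t * u) := by
    intro t ht u
    obtain ⟨F, hF, hFb⟩ := hpos u
    have h1 : (fun r : ℝ => F (max r 0)) = fun r => b 1 (max r 0 * u) := by
      refine Rat.denseRange_cast.equalizer (hF.comp (by fun_prop)) (hc.comp (by fun_prop)) ?_
      ext q
      simp only [Function.comp_apply]
      rw [hFb _ (le_max_right _ _)]
      rcases le_total (q : ℝ) 0 with hq | hq
      · rw [max_eq_right hq, zero_mul, hl0, hr0]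
      · rw [max_eq_left hq]
        have hnum : ((q.num.toNat : ℕ) : ℝ) = q.num := by
          exact_mod_cast Int.toNat_of_nonneg (Rat.num_nonneg.2 (by exact_mod_cast hq))
        have hq' : (q : ℝ) = (q.num.toNat : ℕ) / (q.den : ℕ) := by
          rw [hnum]; exact_mod_cast (Rat.num_div_den q).symm
        rw [hq']
        exact hnnrat _ _ q.den_ne_zero u
    have h2 := congrFun h1 t
    simp only [max_eq_left ht] at h2
    rw [← h2, hFb t ht]
  rcases le_total 0 t with ht | ht
  · exact hnonneg t ht u
  · have h1 := hnonneg (-t) (by linarith) u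
    rw [hlneg, neg_mul, hrneg, inv_inj] at h1
    exact h1

variable {G Q : Type*} [Group G] [TopologicalSpace G] [IsTopologicalGroup G] [ScalableGroup G]
  [Group Q] [TopologicalSpace Q] [IsTopologicalGroup Q] [ScalableGroup Q] {ι : Type*} {a : ι → G}

/-- In class `s + 1`, with `s ≥ 1`, the last term of the lower central series is generated by the
one-parameter subgroups `u ↦ ⁅x_j, δ_u a_i⁆`, where `x_j` lifts the value at `1` of a curve of top
degree in the quotient. -/
theorem exists_generating_curves [T2Space G] [Finite ι] {s : ℕ} (hs : s ≠ 0)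
    (hnil : (⊤ : Subgroup G).lowerCentralSeries (s + 1) = ⊥) {π : G →* Q}
    (hπ : IsOpenQuotientMap π) (hπd : ∀ t g, π (dil t g) = dil t (π g))
    (hker : ∀ g, π g = 1 ↔ g ∈ ((⊤ : Subgroup G).lowerCentralSeries s).topologicalClosure)
    (ha : ∀ i, a i ∈ firstLayer G)
    (hgen : Subgroup.closure {x : G | ∃ i, ∃ t : ℝ, x = dil t (a i)} = ⊤)
    (C : HomogeneousChart Q s) :
    ∃ (N : ℕ) (c : Fin N → ℝ → G), (∀ w, Continuous (c w)) ∧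
      (∀ w t u, c w (t + u) = c w t * c w u) ∧
      (∀ w (l t : ℝ), dil l (c w t) = c w (l ^ (s + 1) * t)) ∧ (∀ w, c w ∈ wordMaps ℝ a) ∧
      (⊤ : Subgroup G).lowerCentralSeries s = Subgroup.closure {x | ∃ w t, x = c w t} := by
  set Γ : ℕ → Subgroup G := (⊤ : Subgroup G).lowerCentralSeries with hΓ
  have hcen : Γ s ≤ Subgroup.center G :=
    Subgroup.commutator_top_right_eq_bot_iff_le_center.1 hnil
  have hkercen : ∀ z, π z = 1 → z ∈ Subgroup.center G := by
    intro z hz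
    have hcl : IsClosed (Subgroup.center G : Set G) := by
      have : (Subgroup.center G : Set G) = ⋂ g : G, {z | g * z = z * g} := by
        ext z; simp [Subgroup.mem_center_iff]
      rw [this]
      exact isClosed_iInter fun g => isClosed_eq (by fun_prop) (by fun_prop)
    exact Subgroup.topologicalClosure_minimal _ hcen hcl ((hker z).1 hz)
  have hker1 : ∀ z, π z = 1 → ∀ y : G, ⁅z, y⁆ = 1 := fun z hz y =>
    commutatorElement_eq_one_iff_mul_comm.2 (Subgroup.mem_center_iff.1 (hkercen z hz) y).symm
  -- Commutators only depend on the image in the quotient, as the kernel of `π` is central.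
  have hindep : ∀ x x' y : G, π x = π x' → ⁅x, y⁆ = ⁅x', y⁆ := by
    intro x x' y h
    have hz : π (x'⁻¹ * x) = 1 := by rw [map_mul, map_inv, h, inv_mul_cancel]
    have h1 : ⁅x' * (x'⁻¹ * x), y⁆ = ⁅x', y⁆ * ⁅x'⁻¹ * x, y⁆ :=
      commutatorElement_mul_left_of_central (by rw [hker1 _ hz]; exact one_mem _)
    rwa [hker1 _ hz, mul_inv_cancel_left, mul_one] at h1
  have hmap : ∀ m, ((⊤ : Subgroup Q).lowerCentralSeries m) = (Γ m).map π := fun m => by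
    rw [hΓ, Subgroup.map_lowerCentralSeries, ← MonoidHom.range_eq_map,
      MonoidHom.range_eq_top.2 hπ.surjective]
  have hcomm : ∀ x y : G, π x ∈ lcsFiltration Q s → ⁅x, y⁆ ∈ Γ s := by
    intro x y hx
    rw [lcsFiltration, hmap] at hx
    obtain ⟨x', hx', h⟩ := hx
    rw [hindep x x' y h.symm]
    have := Subgroup.commutator_mem_commutator hx' (Subgroup.mem_top y)
    rwa [hΓ, ← Subgroup.lowerCentralSeries_succ, Nat.sub_add_cancel (Nat.pos_of_ne_zero hs)] at this
  have hcommc : ∀ x y : G, π x ∈ lcsFiltration Q s → ⁅x, y⁆ ∈ Subgroup.center G := fun x y hx =>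
    hcen (hcomm x y hx)
  -- The index set: a top degree curve of the quotient and one of the generators.
  let J := {j : Fin C.n // C.deg j = s}
  have hlift : ∀ q, ∃ x, π x = q := hπ.surjective
  choose X hX using hlift
  have hcurve : ∀ (j : J) t, C.curve j t ∈ lcsFiltration Q s := fun j t => by
    have := C.curve_mem j t
    rwa [j.2] at this
  let c : J × ι → ℝ → G := fun w u => ⁅X (C.curve w.1 1), dil u (a w.2)⁆
  have hXmem : ∀ (j : J) t, π (X (C.curve j t)) ∈ lcsFiltration Q s := fun j t => by
    rw [hX]; exact hcurve j t
  have hcadd : ∀ w t u, c w (t + u) = c w t * c w u := fun w t u => by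
    simp only [c]
    rw [ha w.2 t u, commutatorElement_mul_right_of_central (hcommc _ _ (hXmem _ _))]
  have hccont : ∀ w, Continuous (c w) := fun w => by
    have h1 : Continuous fun u : ℝ => dil u (a w.2) := Continuous.dil continuous_id continuous_const
    simp only [c, commutatorElement_def]
    fun_prop
  have hdilX : ∀ (j : J) (l : ℝ), π (dil l (X (C.curve j 1))) = C.curve j (l ^ s) := fun j l => by
    rw [hπd, hX, C.dil_curve, j.2, mul_one]
  -- Bilinearity: `⁅x_j(t), δ_u a_i⁆ = ⁅x_j(1), δ_{tu} a_i⁆`. For `t ≥ 0`, the lift of `x_j(t)` may be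
  -- chosen continuously, as the dilation of the lift of `x_j(1)` by `t ^ (1 / s)`.
  have hkey : ∀ (w : J × ι) (t u : ℝ) (x : G), π x = C.curve w.1 t →
      ⁅x, dil u (a w.2)⁆ = c w (t * u) := by
    intro w t u x hx
    rw [hindep x (X (C.curve w.1 t)) _ (by rw [hX, hx])]
    refine biadditive_eq (b := fun t u => ⁅X (C.curve w.1 t), dil u (a w.2)⁆) ?_ ?_
      (hccont w) ?_ t u
    · intro t t' u
      rw [← commutatorElement_mul_left_of_central (hcommc _ _ (hXmem _ _))]
      exact hindep _ _ _ (by rw [map_mul, hX, hX, hX, C.curve_add])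
    · intro t u u'
      rw [ha w.2 u u', commutatorElement_mul_right_of_central (hcommc _ _ (hXmem _ _))]
    · intro u
      refine ⟨fun t => ⁅dil (t ^ ((s : ℝ)⁻¹)) (X (C.curve w.1 1)), dil u (a w.2)⁆, ?_, ?_⟩
      · have hroot : Continuous fun r : ℝ => r ^ ((s : ℝ)⁻¹) :=
          Real.continuous_rpow_const (by positivity)
        have h1 : Continuous fun t : ℝ => dil (t ^ ((s : ℝ)⁻¹)) (X (C.curve w.1 1)) :=
          Continuous.dil hroot continuous_const
        simp only [commutatorElement_def]
        fun_prop
      · intro t ht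
        exact hindep _ _ _ (by rw [hdilX, Real.rpow_inv_natCast_pow ht hs, hX])
  have hcdil : ∀ w (l t : ℝ), dil l (c w t) = c w (l ^ (s + 1) * t) := fun w l t => by
    simp only [c]
    rw [dil_commutatorElement, dil_dil, hkey w _ _ _ (hdilX w.1 l), pow_succ, mul_assoc]
  have hcword : ∀ w, c w ∈ wordMaps ℝ a := fun w => by
    have h1 := const_mem_wordMaps (X := ℝ) hgen (X (C.curve w.1 1))
    have h2 := dil_mem_wordMaps (X := ℝ) (a := a) w.2 differentiable_id
    exact mul_mem (mul_mem (mul_mem h1 h2) (inv_mem h1)) (inv_mem h2)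
  obtain ⟨N, ⟨e⟩⟩ := Finite.exists_equiv_fin (J × ι)
  refine ⟨N, fun w => c (e.symm w), fun w => hccont _, fun w => hcadd _, fun w => hcdil _,
    fun w => hcword _, le_antisymm ?_ ?_⟩
  · set K := Subgroup.closure {x | ∃ w t, x = c (e.symm w) t} with hK
    have hcK : ∀ w t, c w t ∈ K := fun w t =>
      Subgroup.subset_closure ⟨e w, t, by rw [e.symm_apply_apply]⟩
    -- Commutators with a fixed lift of a top curve land in `K`.
    have hgenK : ∀ (j : J) t x, π x = C.curve j t → ∀ y, ⁅x, y⁆ ∈ K := by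
      intro j t x hx y
      have hxm : π x ∈ lcsFiltration Q s := hx ▸ hcurve j t
      have hy : y ∈ Subgroup.closure {x : G | ∃ i, ∃ t : ℝ, x = dil t (a i)} :=
        hgen ▸ Subgroup.mem_top y
      induction hy using Subgroup.closure_induction with
      | mem y hy =>
        obtain ⟨i, u, rfl⟩ := hy
        rw [hkey (j, i) t u x hx]
        exact hcK _ _
      | one => rw [commutatorElement_one_right]; exact one_mem _
      | mul y y' _ _ h h' =>
        rw [commutatorElement_mul_right_of_central (hcommc x y' hxm)]
        exact mul_mem h h'
      | inv y _ h =>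
        have h1 := commutatorElement_mul_right_of_central (y := y) (hcommc x y⁻¹ hxm)
        rw [mul_inv_cancel, commutatorElement_one_right, eq_comm, mul_eq_one_iff_inv_eq] at h1
        rw [← h1]
        exact inv_mem h
    have hall : ∀ q ∈ lcsFiltration Q s, ∀ x, π x = q → ∀ y, ⁅x, y⁆ ∈ K := by
      intro q hq
      replace hq := C.lcsFiltration_le hq
      have hsub : Subgroup.closure {x | ∃ j, ∃ t, C.deg j = s ∧ x = C.curve j t} ≤
          lcsFiltration Q s := by
        rw [Subgroup.closure_le]
        rintro _ ⟨j, t, hj, rfl⟩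
        exact hcurve ⟨j, hj⟩ t
      induction hq using Subgroup.closure_induction with
      | mem q hq =>
        obtain ⟨j, t, hj, rfl⟩ := hq
        exact hgenK ⟨j, hj⟩ t
      | one => intro x hx y; rw [hker1 x hx]; exact one_mem _
      | mul q q' hq hq' h h' =>
        intro x hx y
        rw [hindep x (X q * X q') y (by rw [hx, map_mul, hX, hX]),
          commutatorElement_mul_left_of_central (hcommc _ _ (by rw [hX]; exact hsub hq'))]
        exact mul_mem (h _ (hX q) y) (h' _ (hX q') y)
      | inv q hq h =>
        intro x hx y
        have hx' : π x⁻¹ = q := by rw [map_inv, hx, inv_inv]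
        have h1 := commutatorElement_mul_left_of_central (x := x)
          (hcommc x⁻¹ y (by rw [hx']; exact hsub hq))
        rw [mul_inv_cancel, commutatorElement_one_left, eq_comm, mul_eq_one_iff_eq_inv] at h1
        rw [h1]
        exact inv_mem (h _ hx' y)
    obtain ⟨r, rfl⟩ := Nat.exists_eq_succ_of_ne_zero hs
    rw [hΓ, Subgroup.lowerCentralSeries_succ, Subgroup.commutator_le]
    intro x hx y _
    refine hall (π x) ?_ x rfl y
    rw [lcsFiltration, hmap]
    exact Subgroup.mem_map_of_mem π hx
  · rw [Subgroup.closure_le]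
    rintro _ ⟨w, t, rfl⟩
    exact hcomm _ _ (hXmem _ _)

end Commutators

/-! ### Nilpotent scalable groups of finite rank have charts -/

section Existence

/-- The dilations on the quotient by a normal subgroup that they preserve. -/
@[reducible] def quotient {G : Type*} [Group G] [TopologicalSpace G] [IsTopologicalGroup G]
    [ScalableGroup G] (N : Subgroup G) [N.Normal] (hN : ∀ (t : ℝ), ∀ x ∈ N, dil t x ∈ N) :
    ScalableGroup (G ⧸ N) :=
  ofHom (fun t => QuotientGroup.map N N (dilHom t) fun x hx => hN t x hx)
    (by
      have hq : IsOpenQuotientMap (Prod.map (id : ℝ → ℝ) (QuotientGroup.mk : G → G ⧸ N)) :=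
        IsOpenQuotientMap.id.prodMap QuotientGroup.isOpenQuotientMap_mk
      rw [hq.isQuotientMap.continuous_iff]
      exact QuotientGroup.continuous_mk.comp continuous_dil)
    (fun s t p => by
      induction p using QuotientGroup.induction_on with
      | H p => exact congrArg QuotientGroup.mk (dil_dil s t p))
    (fun p => by
      induction p using QuotientGroup.induction_on with
      | H p => exact congrArg QuotientGroup.mk (dil_zero p))
    (fun p => by
      induction p using QuotientGroup.induction_on with
      | H p => exact congrArg QuotientGroup.mk (dil_one p))

/-- A Hausdorff nilpotent scalable group generated by finitely many points of its first layer has a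
homogeneous chart, in which polynomial maps are polynomial and whose inverse is a word map. -/
theorem exists_homogeneousChart.{u, v} {ι : Type v} [Finite ι] (s : ℕ) :
    ∀ (G : Type u) [Group G] [TopologicalSpace G] [IsTopologicalGroup G] [ScalableGroup G]
      [T2Space G] (a : ι → G), (∀ i, a i ∈ firstLayer G) →
      Subgroup.closure {x : G | ∃ i, ∃ t : ℝ, x = dil t (a i)} = ⊤ →
      (⊤ : Subgroup G).lowerCentralSeries s = ⊥ →
      ∃ C : HomogeneousChart G s, C.IsPolynomial ∧
        ⇑C.toHomeo.symm ∈ wordMaps (Fin C.n → ℝ) a := by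
  induction s with
  | zero =>
    intro G _ _ _ _ _ a ha hgen hnil
    have hsub : Subsingleton G := by
      rw [Subgroup.lowerCentralSeries_zero] at hnil
      exact ⟨fun x y => by
        have hx : x ∈ (⊥ : Subgroup G) := hnil ▸ Subgroup.mem_top x
        have hy : y ∈ (⊥ : Subgroup G) := hnil ▸ Subgroup.mem_top y
        rw [Subgroup.mem_bot.1 hx, Subgroup.mem_bot.1 hy]⟩
    refine ⟨.trivial, fun L f _ _ j => j.elim0, ?_⟩
    have h1 : ⇑(HomogeneousChart.trivial (G := G)).toHomeo.symm = 1 :=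
      funext fun _ => Subsingleton.elim _ _
    rw [h1]
    exact one_mem _
  | succ s ih =>
    intro G _ _ _ _ _ a ha hgen hnil
    set Z := ((⊤ : Subgroup G).lowerCentralSeries s).topologicalClosure with hZ
    have : Z.Normal := Subgroup.is_normal_topologicalClosure _
    have hZd : ∀ (t : ℝ), ∀ x ∈ Z, dil t x ∈ Z := by
      intro t
      have hmap : Set.MapsTo (dil t) ((⊤ : Subgroup G).lowerCentralSeries s : Set G)
          ((⊤ : Subgroup G).lowerCentralSeries s : Set G) := by
        intro x hx
        have h1 := Subgroup.mem_map_of_mem (dilHom t) hx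
        rw [Subgroup.map_lowerCentralSeries] at h1
        exact Subgroup.lowerCentralSeries_mono _ le_top h1
      exact hmap.closure (Continuous.dil continuous_const continuous_id)
    have : IsClosed (Z : Set G) := Subgroup.isClosed_topologicalClosure _
    let : ScalableGroup (G ⧸ Z) := quotient Z hZd
    let π : G →* G ⧸ Z := QuotientGroup.mk' Z
    have hπ : IsOpenQuotientMap π := QuotientGroup.isOpenQuotientMap_mk
    have hπd : ∀ t g, π (dil t g) = dil t (π g) := fun t g => rfl
    have hker : ∀ g, π g = 1 ↔ g ∈ Z := fun g => QuotientGroup.eq_one_iff g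
    obtain ⟨C, hC, hCw⟩ := ih (G ⧸ Z) (π ∘ a)
      (fun i t u => by
        simp only [Function.comp_apply, ← hπd]
        rw [ha i t u, map_mul])
      (by
        have h1 : {x : G ⧸ Z | ∃ i, ∃ t : ℝ, x = dil t ((π ∘ a) i)} =
            π '' {x : G | ∃ i, ∃ t : ℝ, x = dil t (a i)} := by
          ext x
          constructor
          · rintro ⟨i, t, rfl⟩
            exact ⟨_, ⟨i, t, rfl⟩, rfl⟩
          · rintro ⟨_, ⟨i, t, rfl⟩, rfl⟩
            exact ⟨i, t, rfl⟩
        rw [h1, ← MonoidHom.map_closure, hgen, ← MonoidHom.range_eq_map,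
          MonoidHom.range_eq_top.2 hπ.surjective])
      (by
        rw [← MonoidHom.range_eq_top.2 hπ.surjective, MonoidHom.range_eq_map,
          ← Subgroup.map_lowerCentralSeries, Subgroup.map_eq_bot_iff]
        intro x hx
        exact (hker x).2 (Subgroup.le_topologicalClosure _ hx))
    have hcurves : ∃ (N : ℕ) (c : Fin N → ℝ → G), (∀ w, Continuous (c w)) ∧
        (∀ w t u, c w (t + u) = c w t * c w u) ∧
        (∀ w (l t : ℝ), dil l (c w t) = c w (l ^ (s + 1) * t)) ∧ (∀ w, c w ∈ wordMaps ℝ a) ∧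
        (⊤ : Subgroup G).lowerCentralSeries s = Subgroup.closure {x | ∃ w t, x = c w t} := by
      rcases eq_or_ne s 0 with rfl | hs
      · obtain ⟨N, ⟨e⟩⟩ := Finite.exists_equiv_fin ι
        refine ⟨N, fun w t => dil t (a (e.symm w)),
          fun w => Continuous.dil continuous_id continuous_const, fun w => ha _,
          fun w l t => by rw [dil_dil, zero_add, pow_one],
          fun w => dil_mem_wordMaps _ differentiable_id, ?_⟩
        rw [Subgroup.lowerCentralSeries_zero, ← hgen]
        congr 1
        ext x
        constructor
        · rintro ⟨i, t, rfl⟩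
          exact ⟨e i, t, by simp only [e.symm_apply_apply]⟩
        · rintro ⟨w, t, rfl⟩
          exact ⟨_, t, rfl⟩
      · exact exists_generating_curves hs hnil hπ hπd hker ha hgen C
    obtain ⟨N, c, hc, hadd, hdil, hword, hlcs⟩ := hcurves
    obtain ⟨k, L, hL, hLw, htop⟩ :=
      exists_centralLayer hnil hπ hπd hker hc hadd hdil hword hlcs
    exact L.exists_chart_isPolynomial hnil ha C hC (by rw [hL]; exact hCw) hLw htop

end Existence

end ScalableGroup

/-! ### Haar null sets of a group with a chart -/

section Haar

variable {G : Type*} [Group G] [TopologicalSpace G] [IsTopologicalGroup G] [MeasurableSpace G]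
  [BorelSpace G] [SecondCountableTopology G]

/-- A set is null for a left-invariant measure if and only if almost all left translates of any
given curve, or of any given measurable family of points, meet it in a null set of parameters. -/
theorem measure_eq_zero_iff_ae_translate {T : Type*} [MeasurableSpace T] (μ : Measure G) [SFinite μ]
    [μ.IsMulLeftInvariant] (ν : Measure T) [SFinite ν] [NeZero ν] {c : T → G} (hc : Measurable c)
    {E : Set G} (hE : MeasurableSet E) :
    μ E = 0 ↔ ∀ᵐ x ∂μ, ν {t | x * c t ∈ E} = 0 := by
  set S : Set (G × T) := {p | p.1 * c p.2 ∈ E} with hS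
  have hSm : MeasurableSet S :=
    (measurable_fst.mul (hc.comp measurable_snd)) hE
  have h1 : μ.prod ν S = 0 ↔ ∀ᵐ x ∂μ, ν {t | x * c t ∈ E} = 0 := Measure.measure_prod_null hSm
  have h2 : μ.prod ν S = 0 ↔ ∀ᵐ t ∂ν, μ ((fun x => x * c t) ⁻¹' E) = 0 := by
    rw [← Measure.prod_swap, Measure.map_apply measurable_swap hSm]
    exact Measure.measure_prod_null (measurable_swap hSm)
  rw [← h1, h2]
  simp only [measure_mul_right_null]
  exact Filter.eventually_const.symm

end Haar

namespace ScalableGroup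

open Topology Filter

section Chart

variable {G : Type*} [Group G] [TopologicalSpace G] [IsTopologicalGroup G] [ScalableGroup G]
  {s : ℕ} {C : HomogeneousChart G s} {ι : Type*} {a : ι → G}

/-- Left translations are polynomial in the coordinates. -/
theorem HomogeneousChart.IsPolynomial.differentiable_mul_left (hC : C.IsPolynomial) (g : G) :
    Differentiable ℝ fun x => C.toHomeo (g * C.toHomeo.symm x) := by
  refine hC.differentiable (by fun_prop) fun k => ?_
  refine (IsPolyMap.const k g).mul (C.isPolyMap_symm_comp (q := id) (fun j => ?_) k)
  obtain ⟨d, hd⟩ := Nat.exists_eq_succ_of_ne_zero (C.deg_ne_zero j)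
  rw [hd]
  exact IsPolyDeg.of_additive (Pi.evalAddMonoidHom (fun _ : Fin C.n => ℝ) j) d

variable [MeasurableSpace G] [BorelSpace G]

/-- Haar null sets are Lebesgue null in the coordinates: a translate of the set is Lebesgue null
by Fubini's theorem, and left translations are differentiable in the coordinates. -/
theorem HomogeneousChart.IsPolynomial.volume_preimage_symm_eq_zero (hC : C.IsPolynomial)
    (μ : Measure G) [SFinite μ] [μ.IsMulLeftInvariant] [NeZero μ] {E : Set G}
    (hE : MeasurableSet E) (h : μ E = 0) : volume (C.toHomeo.symm ⁻¹' E) = 0 := by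
  have : SecondCountableTopology G := C.toHomeo.secondCountableTopology
  have h1 := (measure_eq_zero_iff_ae_translate μ (volume : Measure (Fin C.n → ℝ))
    C.toHomeo.symm.continuous.measurable hE).1 h
  obtain ⟨g, hg⟩ := h1.exists
  have h2 := addHaar_image_eq_zero_of_differentiableOn_of_addHaar_eq_zero volume
    (hC.differentiable_mul_left g).differentiableOn hg
  refine measure_mono_null (fun x hx => ?_) h2
  refine ⟨C.toHomeo (g⁻¹ * C.toHomeo.symm x), ?_, ?_⟩
  · simpa using hx
  · simp

/-- Some word in the points `a` pulls all Haar null sets back to Lebesgue null sets: in coordinates,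
it is a polynomial map, and its derivative is onto at some point because a differentiable map into
the parameters of the word is a right inverse. -/
theorem HomogeneousChart.IsPolynomial.exists_word_preimage_null (hC : C.IsPolynomial)
    (ha : ∀ i, a i ∈ firstLayer G) (hsymm : ⇑C.toHomeo.symm ∈ wordMaps (Fin C.n → ℝ) a) :
    ∃ (L : ℕ) (w : Fin L → ι), ∀ (μ : Measure G) [SFinite μ] [μ.IsMulLeftInvariant] [NeZero μ]
      (E : Set G), MeasurableSet E → μ E = 0 → volume (wordMap a w ⁻¹' E) = 0 := by
  obtain ⟨L, w, α, hα, hw⟩ := exists_word ha hsymm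
  refine ⟨L, w, fun μ _ _ _ E hE h => ?_⟩
  set f : (Fin L → ℝ) → Fin C.n → ℝ := fun t => C.toHomeo (wordMap a w t) with hf
  have hcont := continuous_wordMap a w
  have hpoly := fun k => isPolyMap_wordMap ha w k
  obtain ⟨P, hP⟩ := hC.exists_mvPolynomial hcont hpoly
  have hfd : HasFDerivAt f (fderiv ℝ f (α 0)) (α 0) :=
    (hC.differentiable hcont hpoly (α 0)).hasFDerivAt
  have hid : f ∘ α = id := funext fun x => by simp [hf, ← hw]
  have hcomp : (fderiv ℝ f (α 0)).comp (fderiv ℝ α 0) = .id ℝ _ :=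
    (hfd.comp 0 (hα 0).hasFDerivAt).unique (hid ▸ hasFDerivAt_id 0)
  have hsurj : Function.Surjective (fderiv ℝ f (α 0)) := fun y =>
    ⟨fderiv ℝ α 0 y, DFunLike.congr_fun hcomp y⟩
  have h1 := preimage_null_of_polynomial P hP hfd hsurj
    (hC.volume_preimage_symm_eq_zero μ hE h)
  simpa [hf, Set.preimage, Function.comp_def] using h1

end Chart

/-! ### The exceptional classes -/

section Exceptional

variable {G : Type*} [Group G] [TopologicalSpace G] [IsTopologicalGroup G] [ScalableGroup G]
  [MeasurableSpace G]

theorem exceptionalAt_of_subset {b : G} {A B : Set G} (hB : B ∈ exceptionalAt b) (hAB : A ⊆ B)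
    (hA : MeasurableSet A) : A ∈ exceptionalAt b :=
  ⟨hA, fun g => measure_mono_null (fun _ ht => hAB ht) (hB.2 g)⟩

theorem empty_mem_exceptionalAt (b : G) : ∅ ∈ exceptionalAt b :=
  ⟨.empty, fun g => by simp⟩

theorem iUnion_mem_exceptionalAt {b : G} {κ : Type*} [Countable κ] {A : κ → Set G}
    (hA : ∀ m, A m ∈ exceptionalAt b) : ⋃ m, A m ∈ exceptionalAt b := by
  refine ⟨.iUnion fun m => (hA m).1, fun g => ?_⟩
  have h : {t : ℝ | g * dil t b ∈ ⋃ m, A m} = ⋃ m, {t : ℝ | g * dil t b ∈ A m} := by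
    ext t; simp
  rw [h, measure_iUnion_null_iff]
  exact fun m => (hA m).2 g

variable [BorelSpace G]

theorem measurableSet_line {b : G} {A : Set G} (hA : MeasurableSet A) :
    MeasurableSet {p : G × ℝ | p.1 * dil p.2 b ∈ A} := by
  have h : Continuous fun p : G × ℝ => p.1 * dil p.2 b :=
    continuous_fst.mul (Continuous.dil continuous_snd continuous_const)
  exact h.measurable hA

/-- The points of `A` whose line in the direction `b` meets `A` in a null set form a set that is
exceptional in the direction `b`: two points of one line have the same line. -/
theorem diff_mem_exceptionalAt {b : G} (hb : b ∈ firstLayer G) {A : Set G} (hA : MeasurableSet A) :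
    A \ {x | volume {t : ℝ | x * dil t b ∈ A} ≠ 0} ∈ exceptionalAt b := by
  refine ⟨hA.diff (measurable_measure_prodMk_left (measurableSet_line hA)
    (measurableSet_singleton 0).compl), fun g => ?_⟩
  by_cases h : ∃ t₀, g * dil t₀ b ∈ A \ {x | volume {t : ℝ | x * dil t b ∈ A} ≠ 0}
  · obtain ⟨t₀, -, ht₀⟩ := h
    have h1 : volume ((fun t => t₀ + t) ⁻¹' {t : ℝ | g * dil t b ∈ A}) = 0 := by
      simpa [Set.preimage, hb t₀, mul_assoc] using ht₀
    rw [measure_preimage_add] at h1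
    exact measure_mono_null (fun t ht => ht.1) h1
  · have h1 : {t | g * dil t b ∈ A \ {x | volume {t : ℝ | x * dil t b ∈ A} ≠ 0}} = ∅ :=
      Set.eq_empty_of_forall_notMem fun t ht => h ⟨t, ht⟩
    rw [h1, measure_empty]

variable {ι : Type*}

/-- The points from which the word `w` reaches `B` along sets of positive measure, one letter at a
time. -/
def reach (a : ι → G) (B : Set G) : ∀ {L : ℕ}, (Fin L → ι) → Set G
  | 0, _ => B
  | _ + 1, w => {x | volume {t : ℝ | x * dil t (a (w 0)) ∈ reach a B (Fin.tail w)} ≠ 0}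

theorem measurableSet_reach (a : ι → G) {B : Set G} (hB : MeasurableSet B) {L : ℕ}
    (w : Fin L → ι) : MeasurableSet (reach a B w) := by
  induction L with
  | zero => exact hB
  | succ L ih =>
    exact measurable_measure_prodMk_left (measurableSet_line (ih (Fin.tail w)))
      (measurableSet_singleton 0).compl

/-- By Fubini's theorem, a point from which the word leads into `B` only for a null set of parameters
does not reach `B` one letter at a time. -/
theorem notMem_reach {a : ι → G} {B : Set G} (hB : MeasurableSet B) {L : ℕ} (w : Fin L → ι) (x : G)
    (h : volume {t : Fin L → ℝ | x * wordMap a w t ∈ B} = 0) : x ∉ reach a B w := by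
  induction L generalizing x with
  | zero =>
    intro hx
    have h1 : {t : Fin 0 → ℝ | x * wordMap a w t ∈ B} = Set.univ :=
      Set.eq_univ_of_forall fun t => by simpa [wordMap, reach] using hx
    rw [h1] at h
    exact NeZero.ne (volume (Set.univ : Set (Fin 0 → ℝ))) h
  | succ L ih =>
    have hcons : Continuous fun p : ℝ × (Fin L → ℝ) =>
        x * (dil p.1 (a (w 0)) * wordMap a (Fin.tail w) p.2) :=
      continuous_const.mul ((Continuous.dil continuous_fst continuous_const).mul
        ((continuous_wordMap a _).comp continuous_snd))
    have hS := hcons.measurable hB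
    have h1 := (volume_preserving_piFinSuccAbove (fun _ : Fin (L + 1) => ℝ) 0).measure_preimage
      hS.nullMeasurableSet
    have h2 : (volume : Measure (ℝ × (Fin L → ℝ))) ((fun p : ℝ × (Fin L → ℝ) =>
        x * (dil p.1 (a (w 0)) * wordMap a (Fin.tail w) p.2)) ⁻¹' B) = 0 := by
      rw [← h1, ← h]
      congr 1
      ext t
      simp only [Set.mem_preimage, Set.mem_ofPred_eq, wordMap_cons a w t]
      rfl
    rw [Measure.volume_eq_prod, Measure.measure_prod_null hS] at h2
    simp only [reach, Set.mem_ofPred_eq, not_not]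
    refine measure_eq_zero_iff_ae_notMem.2 ?_
    filter_upwards [h2] with t ht
    refine ih _ _ ?_
    simp only [mul_assoc]
    exact ht

/-- A Borel set to which the word `w` leads from no point, up to null sets of parameters, is covered
by exceptional sets in the directions of the letters of `w`. -/
theorem exists_exceptionalAt_cover {a : ι → G} (ha : ∀ i, a i ∈ firstLayer G) {B : Set G}
    (hB : MeasurableSet B) {L : ℕ} (w : Fin L → ι)
    (h : ∀ x, volume {t : Fin L → ℝ | x * wordMap a w t ∈ B} = 0) :
    ∃ D : ι → Set G, (∀ i, D i ∈ exceptionalAt (a i)) ∧ B ⊆ ⋃ i, D i := by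
  have key : ∀ {L : ℕ} (w : Fin L → ι), ∃ D : ι → Set G, (∀ i, D i ∈ exceptionalAt (a i)) ∧
      B ⊆ reach a B w ∪ ⋃ i, D i := by
    intro L
    induction L with
    | zero => exact fun w => ⟨fun _ => ∅, fun i => empty_mem_exceptionalAt _, Set.subset_union_left⟩
    | succ L ih =>
      intro w
      classical
      obtain ⟨D, hD, hBD⟩ := ih (Fin.tail w)
      have hnew := diff_mem_exceptionalAt (ha (w 0)) (measurableSet_reach a hB (Fin.tail w))
      refine ⟨fun i => ⋃ r : Bool, if r then D i else if w 0 = i then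
        reach a B (Fin.tail w) \ reach a B w else ∅, fun i => ?_, fun x hx => ?_⟩
      · refine iUnion_mem_exceptionalAt fun r => ?_
        split_ifs with h1 h2
        · exact hD i
        · exact h2 ▸ hnew
        · exact empty_mem_exceptionalAt _
      · by_cases hxw : x ∈ reach a B w
        · exact Or.inl hxw
        · refine Or.inr ?_
          rcases hBD hx with h1 | h1
          · exact Set.mem_iUnion.2 ⟨w 0, Set.mem_iUnion.2 ⟨false, by simp [h1, hxw]⟩⟩
          · obtain ⟨i, hi⟩ := Set.mem_iUnion.1 h1
            exact Set.mem_iUnion.2 ⟨i, Set.mem_iUnion.2 ⟨true, by simp [hi]⟩⟩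
  obtain ⟨D, hD, hBD⟩ := key w
  refine ⟨D, hD, fun x hx => ?_⟩
  exact (hBD hx).resolve_left (notMem_reach hB w x (h x))

end Exceptional

end ScalableGroup

/-! ### The subgroups generated by finitely many lines -/

section Closed

open Topology

/-- A locally compact subgroup of a Hausdorff group is closed: near the identity it agrees with a
compact set. -/
theorem Subgroup.isClosed_of_locallyCompactSpace {G : Type*} [Group G] [TopologicalSpace G]
    [IsTopologicalGroup G] [T2Space G] (H : Subgroup G) [LocallyCompactSpace H] :
    IsClosed (H : Set G) := by
  obtain ⟨K, hK, hK1⟩ := exists_compact_mem_nhds (1 : H)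
  obtain ⟨V, hV, hVK⟩ := mem_nhds_subtype (H : Set G) 1 K |>.1 hK1
  obtain ⟨U, hUV, hU, hU1⟩ := mem_nhds_iff.1 hV
  have hK' : IsClosed ((↑) '' K : Set G) := (hK.image continuous_subtype_val).isClosed
  have hUK : U ∩ H ⊆ (↑) '' K := fun x hx => ⟨⟨x, hx.2⟩, hVK (hUV hx.1), rfl⟩
  rw [← closure_subset_iff_isClosed]
  intro x hx
  have hnear : {y : G | y⁻¹ * x ∈ U} ∈ 𝓝 x := by
    refine (hU.preimage (by fun_prop : Continuous fun y : G => y⁻¹ * x)).mem_nhds ?_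
    simpa using hU1
  obtain ⟨y, hyU, hyH⟩ := mem_closure_iff_nhds.1 hx _ hnear
  have hcl : y⁻¹ * x ∈ _root_.closure (H : Set G) :=
    H.topologicalClosure.mul_mem (inv_mem (H.le_topologicalClosure hyH)) hx
  have h1 : y⁻¹ * x ∈ (↑) '' K :=
    closure_minimal hUK hK' (hU.inter_closure ⟨hyU, hcl⟩)
  obtain ⟨z, -, hz⟩ := h1
  have h2 : y * z ∈ H := mul_mem hyH z.2
  rwa [hz, mul_inv_cancel_left] at h2

end Closed

namespace ScalableGroup

open Topology Filter

section Lines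

variable {G : Type*} [Group G] [TopologicalSpace G] [IsTopologicalGroup G] [ScalableGroup G]

/-- A subgroup that the dilations preserve is a scalable group. -/
@[reducible] def ofSubgroup (H : Subgroup G) (hH : ∀ (t : ℝ), ∀ x ∈ H, dil t x ∈ H) :
    ScalableGroup H :=
  ofHom (fun t => ((dilHom t).comp H.subtype).codRestrict H fun x => hH t x x.2)
    (Continuous.subtype_mk (Continuous.dil continuous_fst
      (continuous_subtype_val.comp continuous_snd)) _)
    (fun s t p => Subtype.ext (dil_dil s t p.1)) (fun p => Subtype.ext (dil_zero p.1))
    (fun p => Subtype.ext (dil_one p.1))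

theorem dil_mem_initialSubgroup (a : ℕ → G) {i m : ℕ} (hi : i ≤ m) (t : ℝ) :
    dil t (a i) ∈ initialSubgroup a m :=
  Subgroup.le_topologicalClosure _ (Subgroup.subset_closure ⟨a i, ⟨i, hi, rfl⟩, t, rfl⟩)

/-- The group generated by finitely many lines through the identity in the first layer, if it is
nilpotent: it is closed, it is homeomorphic to some `ℝ^n`, and there is a word in the generators
that pulls its Haar null sets back to Lebesgue null sets. -/
theorem exists_word_of_isNilpotent {ι : Type*} [Finite ι] [T2Space G] [MeasurableSpace G]
    [BorelSpace G] {a : ι → G} (ha : ∀ i, a i ∈ firstLayer G) {H : Subgroup G}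
    (hH : H = Subgroup.closure {x : G | ∃ i, ∃ t : ℝ, x = dil t (a i)})
    (hnil : Group.IsNilpotent H) :
    IsClosed (H : Set G) ∧ (∃ n : ℕ, Nonempty (H ≃ₜ (Fin n → ℝ))) ∧
      ∃ (L : ℕ) (w : Fin L → ι), ∀ (μ : Measure H) [SFinite μ] [μ.IsMulLeftInvariant] [NeZero μ]
        (E : Set G), MeasurableSet E → μ {h | (h : G) ∈ E} = 0 →
          volume (wordMap a w ⁻¹' E) = 0 := by
  have hdil : ∀ (t : ℝ), ∀ x ∈ H, dil t x ∈ H := by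
    intro t x hx
    have hle : H ≤ H.comap (dilHom t) := by
      conv_lhs => rw [hH]
      rw [Subgroup.closure_le]
      rintro _ ⟨i, u, rfl⟩
      rw [SetLike.mem_coe, Subgroup.mem_comap, dilHom_apply, dil_dil, hH]
      exact Subgroup.subset_closure ⟨i, _, rfl⟩
    exact hle hx
  have haH : ∀ i t, dil t (a i) ∈ H := fun i t => hH ▸ Subgroup.subset_closure ⟨i, t, rfl⟩
  let b : ι → H := fun i => ⟨a i, by simpa [dil_one] using haH i 1⟩
  let : ScalableGroup H := ofSubgroup H hdil
  have hb : ∀ i, b i ∈ firstLayer H := fun i t u => Subtype.ext (ha i t u)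
  have hgen : Subgroup.closure {x : H | ∃ i, ∃ t : ℝ, x = dil t (b i)} = ⊤ := by
    subst hH
    rw [← Subgroup.closure_closure_coe_preimage]
    congr 1
    ext x
    exact ⟨fun ⟨i, t, h⟩ => ⟨i, t, congrArg Subtype.val h⟩,
      fun ⟨i, t, h⟩ => ⟨i, t, Subtype.ext h⟩⟩
  obtain ⟨s, hs⟩ := Subgroup.nilpotent_iff_lowerCentralSeries.1 hnil
  obtain ⟨C, hC, hsymm⟩ := exists_homogeneousChart s H b hb hgen hs
  have hlc : LocallyCompactSpace H := C.toHomeo.isClosedEmbedding.locallyCompactSpace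
  obtain ⟨L, w, hw⟩ := hC.exists_word_preimage_null hb hsymm
  refine ⟨H.isClosed_of_locallyCompactSpace, ⟨C.n, ⟨C.toHomeo⟩⟩, L, w, fun μ _ _ _ E hE h => ?_⟩
  have hword : ∀ t, ((wordMap b w t : H) : G) = wordMap a w t := fun t => by
    simp only [wordMap]
    rw [← H.coe_subtype, map_list_prod, List.map_ofFn]
    rfl
  have h1 := hw μ _ (measurable_subtype_coe hE) h
  simpa only [Set.preimage, Set.mem_ofPred_eq, hword] using h1

end Lines

/-! ### Exceptional sets and Haar negligible sets -/

section Main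

variable {G : Type*} [Group G] [TopologicalSpace G] [IsTopologicalGroup G] [ScalableGroup G]
  [T2Space G] [MeasurableSpace G] [BorelSpace G] {a : ℕ → G}

/-- The closure in the definition of the subgroup generated by `a 0, …, a m` is superfluous when
that subgroup is nilpotent. -/
theorem exists_word_initialSubgroup (ha : ∀ n, a n ∈ firstLayer G) (m : ℕ)
    (hnil : Group.IsNilpotent (initialSubgroup a m)) :
    (∃ n : ℕ, Nonempty (initialSubgroup a m ≃ₜ (Fin n → ℝ))) ∧
      ∃ (L : ℕ) (w : Fin L → ℕ), ∀ (μ : Measure (initialSubgroup a m)) [SFinite μ]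
        [μ.IsMulLeftInvariant] [NeZero μ] (E : Set G), MeasurableSet E →
          μ {h | (h : G) ∈ E} = 0 → volume (wordMap a w ⁻¹' E) = 0 := by
  set H := Subgroup.closure {x : G | ∃ i : {i // i ≤ m}, ∃ t : ℝ, x = dil t (a i)} with hH
  have hN : initialSubgroup a m = H.topologicalClosure := by
    rw [initialSubgroup, generatedBy, hH]
    congr 2
    ext x
    constructor
    · rintro ⟨_, ⟨i, hi, rfl⟩, t, rfl⟩
      exact ⟨⟨i, hi⟩, t, rfl⟩
    · rintro ⟨⟨i, hi⟩, t, rfl⟩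
      exact ⟨_, ⟨i, hi, rfl⟩, t, rfl⟩
  have hnilH : Group.IsNilpotent H := by
    rw [Subgroup.isNilpotent_iff_lowerCentralSeries] at hnil ⊢
    obtain ⟨s, hs⟩ := hnil
    refine ⟨s, le_bot_iff.1 (hs ▸ Subgroup.lowerCentralSeries_mono s ?_)⟩
    exact hN ▸ H.le_topologicalClosure
  have : Finite {i // i ≤ m} := Set.finite_Iic m
  obtain ⟨hclosed, hhomeo, L, w, hw⟩ :=
    exists_word_of_isNilpotent (fun i : {i // i ≤ m} => ha i) hH hnilH
  have hNH : initialSubgroup a m = H :=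
    hN.trans (le_antisymm (H.topologicalClosure_minimal le_rfl hclosed) H.le_topologicalClosure)
  rw [hNH]
  exact ⟨hhomeo, L, fun j => w j, hw⟩

theorem locallyCompactSpace_initialSubgroup (ha : ∀ n, a n ∈ firstLayer G) (m : ℕ)
    (hnil : Group.IsNilpotent (initialSubgroup a m)) :
    LocallyCompactSpace (initialSubgroup a m) := by
  obtain ⟨⟨n, ⟨e⟩⟩, -⟩ := exists_word_initialSubgroup ha m hnil
  exact e.isClosedEmbedding.locallyCompactSpace

theorem secondCountableTopology_initialSubgroup (ha : ∀ n, a n ∈ firstLayer G) (m : ℕ)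
    (hnil : Group.IsNilpotent (initialSubgroup a m)) :
    SecondCountableTopology (initialSubgroup a m) := by
  obtain ⟨⟨n, ⟨e⟩⟩, -⟩ := exists_word_initialSubgroup ha m hnil
  exact e.secondCountableTopology

/-- Exceptional sets in a direction of `N_m` are Haar null on the translates of `N_m`. -/
theorem isHaarNullOn_of_mem_exceptionalAt (ha : ∀ n, a n ∈ firstLayer G) (m : ℕ)
    (hnil : Group.IsNilpotent (initialSubgroup a m)) {B : Set G} (hB : B ∈ exceptionalAt (a m))
    (g : G) : IsHaarNullOn (initialSubgroup a m) ((fun x => g * x) '' B) := by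
  have hlc := locallyCompactSpace_initialSubgroup ha m hnil
  have hsc := secondCountableTopology_initialSubgroup ha m hnil
  refine ⟨hlc, fun μ hμ => ?_⟩
  simp only [Set.image_mul_left, Set.mem_preimage]
  let c : ℝ → initialSubgroup a m := fun t => ⟨dil t (a m), dil_mem_initialSubgroup a le_rfl t⟩
  have hc : Continuous c :=
    Continuous.subtype_mk (Continuous.dil continuous_id continuous_const) _
  have hmeas : Measurable fun h : initialSubgroup a m => g⁻¹ * (h : G) :=
    (continuous_const.mul continuous_subtype_val).measurable
  refine (measure_eq_zero_iff_ae_translate μ (volume : Measure ℝ) hc.measurable (hmeas hB.1)).2 ?_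
  refine Eventually.of_forall fun h => ?_
  have h1 := hB.2 (g⁻¹ * h)
  simpa [mul_assoc, c] using h1

/-- Sets that are Haar null on the translates of `N_m` are covered by exceptional sets. -/
theorem exists_exceptionalAt_cover_of_isHaarNullOn (ha : ∀ n, a n ∈ firstLayer G) (m : ℕ)
    (hnil : Group.IsNilpotent (initialSubgroup a m)) {B : Set G} (hB : MeasurableSet B)
    (hnull : ∀ g, IsHaarNullOn (initialSubgroup a m) ((fun x => g * x) '' B)) :
    ∃ D : ℕ → Set G, (∀ i, D i ∈ exceptionalAt (a i)) ∧ B ⊆ ⋃ i, D i := by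
  have hlc := locallyCompactSpace_initialSubgroup ha m hnil
  have hsc := secondCountableTopology_initialSubgroup ha m hnil
  obtain ⟨-, L, w, hw⟩ := exists_word_initialSubgroup ha m hnil
  refine exists_exceptionalAt_cover ha hB w fun x => ?_
  have h1 := (hnull x⁻¹).2 Measure.haar inferInstance
  simp only [Set.image_mul_left, Set.mem_preimage, inv_inv] at h1
  have hmeas : Measurable fun y : G => x * y := (continuous_const.mul continuous_id).measurable
  exact hw Measure.haar _ (hmeas hB) h1

end Main

end ScalableGroup

theorem theorem3p4 {G : Type*} [Group G] [MetricSpace G] [IsTopologicalGroup G]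
    [MetricScalableGroup G] [MeasurableSpace G] [BorelSpace G]
    (a : ℕ → G)
    (ha : ∀ n, a n ∈ ScalableGroup.firstLayer G \ {1})
    (hdense : ScalableGroup.firstLayer G \ {1} ⊆ closure (Set.range a))
    (hnil : ∀ m, Group.IsNilpotent (ScalableGroup.initialSubgroup a m))
    (Ω : Set G) :
    Ω ∈ ScalableGroup.exceptional a ↔ IsNegligible (ScalableGroup.initialSubgroup a) Ω := by
  have ha' : ∀ n, a n ∈ ScalableGroup.firstLayer G := fun n => (ha n).1
  constructor
  · rintro ⟨hΩ, B, hB, rfl⟩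
    exact ⟨hΩ, B, fun m => (hB m).1, rfl, fun m g =>
      ScalableGroup.isHaarNullOn_of_mem_exceptionalAt ha' m (hnil m) (hB m) g⟩
  · rintro ⟨hΩ, B, hB, rfl, hnull⟩
    choose D hD hBD using fun m =>
      ScalableGroup.exists_exceptionalAt_cover_of_isHaarNullOn ha' m (hnil m) (hB m) (hnull m)
    have hE : ∀ n, ⋃ m, D m n ∈ ScalableGroup.exceptionalAt (a n) := fun n =>
      ScalableGroup.iUnion_mem_exceptionalAt fun m => hD m n
    refine ⟨hΩ, fun n => (⋃ m, B m) ∩ ⋃ m, D m n, fun n =>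
      ScalableGroup.exceptionalAt_of_subset (hE n) Set.inter_subset_right (hΩ.inter (hE n).1), ?_⟩
    rw [← Set.inter_iUnion, eq_comm, Set.inter_eq_left, Set.iUnion_subset_iff]
    intro m x hx
    obtain ⟨n, hn⟩ := Set.mem_iUnion.1 (hBD m hx)
    exact Set.mem_iUnion.2 ⟨n, Set.mem_iUnion.2 ⟨m, hn⟩⟩
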